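/- Let $q\in\mathbb{C}$ with $q\neq 0$, $|q|\neq 1$, fix a square root $q^{1/2}$ of $q$, and let $n\ge 3$. Let $U=\mathfrak{osp}_q(1|2)$ be the unital associative $\mathbb{C}$-algebra with generators $A_+,A_-,K,K^{-1},P$ and relations $$KA_\pm K^{-1}=q^{\pm1/2}A_\pm,\quad A_+A_-+A_-A_+=\frac{K^2-K^{-2}}{q^{1/2}-q^{-1/2}},\quad PA_\pm+A_\pm P=0,$$ $$PK=KP,\quad PK^{-1}=K^{-1}P,\quad KK^{-1}=K^{-1}K=1,\quad P^2=1,$$ let $\Delta:U\to U\otimes U$ be the algebra morphism with $\Delta(A_\pm)=A_\pm\otimes KP+K^{-1}\otimes A_\pm$, $\Delta(K^{\pm1})=K^{\pm1}\otimes K^{\pm1}$, $\Delta(P)=P\otimes P$ (tensor products of algebras carry the ungraded product), and let $$\Gamma^q=\Big(-A_+A_-+\frac{q^{-1/2}K^2-q^{1/2}K^{-2}}{q-q^{-1}}\Big)P .$$ Let $\mathcal{I}\subseteq U$ be the subalgebra generated by $A_-K$, $A_+K$, $K^2P$, $\Gamma^q$; then $\Delta(\mathcal I)\subseteq U\otimes\mathcal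 I$. Let $\tau:\mathcal I\to U\otimes\mathcal I$ be the algebra morphism with $$\begin{aligned}\tau(A_-K)&=K^2P\otimes A_-K,\\ \tau(A_+K)&=K^{-2}P\otimes A_+K+q^{-1/2}(q-q^{-1})\,A_+^2P\otimes A_-K\\&\quad+q^{-1/2}(q^{1/2}-q^{-1/2})\,A_+K^{-1}P\otimes K^2P+q^{-1/2}(q-q^{-1})\,A_+K^{-1}P\otimes\Gamma^q,\\ \tau(K^2P)&=1\otimes K^2P-(q-q^{-1})\,A_+K\otimes A_-K,\qquad \tau(\Gamma^q)=1\otimes\Gamma^q.\end{aligned}$$ For a non-empty $A\subseteq[n]=\{1,\dots,n\}$ with $m=\min A$, $M=\max A$, define $$\Gamma_A^q=1^{\otimes(m-1)}\otimes\big(\tau^A_{M-1,M}\circ\cdots\circ\tau^A_{m,m+1}\big)(\Gamma^q)\otimes 1^{\otimes(n-M)}\in U^{\otimes n},$$ where, writing $1$ also for identity maps, $\tau^A_{k-1,k}$ is * $1^{\otimes(k-m-1)}\otimes\Delta$ if $k-1\in A$ and $k\in A$; * $(1^{\otimes(k-m)}\otimes\tau)(1^{\otimes(k-m-1)}\otimes\Delta)$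 if $k-1\in A$ and $k\notin A$; * $1^{\otimes(k-m-1)}\otimes\Delta\otimes1$ if $k-1\notin A$ and $k\notin A$; * the identity if $k-1\notin A$ and $k\in A$; and put $\Gamma_\emptyset^q=-\frac{q^{1/2}-q^{-1/2}}{q-q^{-1}}\cdot 1$. Let $\mathcal A_n^q$ be the (unital) subalgebra of $U^{\otimes n}$ generated by all $\Gamma_A^q$ with $A\subseteq[n]$. Then the elements $\Gamma^q_{[i;j]}$ with $1\le i\le j\le n$, where $[i;j]=\{i,i+1,\dots,j\}$, generate the whole algebra $\mathcal A_n^q$. -/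

import Mathlib

open scoped TensorProduct

set_option linter.unusedSimpArgs false
set_option linter.unnecessarySeqFocus false

noncomputable section

namespace QBannaiIto

/-- A deformation parameter: a non-zero complex number `q` with `|q| ≠ 1`, together with a fixed
square root `s` of `q`, which is what the expressions `q^{1/2}` and `q^{-1/2} = s⁻¹` refer to. -/
structure Parameter where
  q : ℂ
  s : ℂ
  s_sq : s ^ 2 = q
  q_ne_zero : q ≠ 0
  norm_q_ne_one : ‖q‖ ≠ 1

/-- The names of the generators of `osp_q(1|2)`: `A₊`, `A₋`, `K`, `K⁻¹` and the grade
involution `P`. -/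
inductive Gen
  | Ap
  | Am
  | K
  | Ki
  | P

variable (p : Parameter)

section Osp

open FreeAlgebra Gen

/-- The defining relations of `osp_q(1|2)`. -/
inductive Rel : FreeAlgebra ℂ Gen → FreeAlgebra ℂ Gen → Prop
  | K_Ap : Rel (ι ℂ K * ι ℂ Ap * ι ℂ Ki) (p.s • ι ℂ Ap)
  | K_Am : Rel (ι ℂ K * ι ℂ Am * ι ℂ Ki) (p.s⁻¹ • ι ℂ Am)
  | Ap_Am : Rel (ι ℂ Ap * ι ℂ Am + ι ℂ Am * ι ℂ Ap)
      ((p.s - p.s⁻¹)⁻¹ • (ι ℂ K ^ 2 - ι ℂ Ki ^ 2))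
  | P_Ap : Rel (ι ℂ P * ι ℂ Ap + ι ℂ Ap * ι ℂ P) 0
  | P_Am : Rel (ι ℂ P * ι ℂ Am + ι ℂ Am * ι ℂ P) 0
  | P_K : Rel (ι ℂ P * ι ℂ K) (ι ℂ K * ι ℂ P)
  | P_Ki : Rel (ι ℂ P * ι ℂ Ki) (ι ℂ Ki * ι ℂ P)
  | K_Ki : Rel (ι ℂ K * ι ℂ Ki) 1
  | Ki_K : Rel (ι ℂ Ki * ι ℂ K) 1
  | P_P : Rel (ι ℂ P ^ 2) 1

/-- The algebra `osp_q(1|2)`, extended by its grade involution `P`. -/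
def Osp : Type := RingQuot (Rel p)

instance : Ring (Osp p) := inferInstanceAs (Ring (RingQuot (Rel p)))

instance : Algebra ℂ (Osp p) := inferInstanceAs (Algebra ℂ (RingQuot (Rel p)))

/-- The canonical map from the free algebra. -/
def mkOsp : FreeAlgebra ℂ Gen →ₐ[ℂ] Osp p := RingQuot.mkAlgHom ℂ (Rel p)

variable {p} in
lemma mkOsp_rel {x y : FreeAlgebra ℂ Gen} (h : Rel p x y) : mkOsp p x = mkOsp p y :=
  RingQuot.mkAlgHom_rel ℂ h

/-- The generator `A₊`. -/
def Ap : Osp p := mkOsp p (ι ℂ Gen.Ap)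
/-- The generator `A₋`. -/
def Am : Osp p := mkOsp p (ι ℂ Gen.Am)
/-- The generator `K`. -/
def K : Osp p := mkOsp p (ι ℂ Gen.K)
/-- The generator `K⁻¹`. -/
def Ki : Osp p := mkOsp p (ι ℂ Gen.Ki)
/-- The grade involution `P`. -/
def P : Osp p := mkOsp p (ι ℂ Gen.P)

/-- The universal property of `osp_q(1|2)`: a morphism is determined by images of the generators
which satisfy the defining relations. -/
def liftOsp {B : Type} [Ring B] [Algebra ℂ B] (g : Gen → B)
    (h : ∀ ⦃x y⦄, Rel p x y → lift ℂ g x = lift ℂ g y) : Osp p →ₐ[ℂ] B :=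
  RingQuot.liftAlgHom ℂ ⟨lift ℂ g, h⟩

lemma liftOsp_mk {B : Type} [Ring B] [Algebra ℂ B] (g : Gen → B)
    (h : ∀ ⦃x y⦄, Rel p x y → lift ℂ g x = lift ℂ g y) (i : Gen) :
    liftOsp p g h (mkOsp p (ι ℂ i)) = g i := by
  have h1 := RingQuot.liftAlgHom_mkAlgHom_apply ℂ (FreeAlgebra.lift ℂ g) h (ι ℂ i)
  rw [FreeAlgebra.lift_ι_apply] at h1
  exact h1

end Osp

section Relations

lemma s_ne_zero : p.s ≠ 0 := fun h => p.q_ne_zero (by rw [← p.s_sq, h]; simp)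

lemma K_Ki : K p * Ki p = 1 := by simpa [K, Ki] using mkOsp_rel (Rel.K_Ki (p := p))
lemma Ki_K : Ki p * K p = 1 := by simpa [K, Ki] using mkOsp_rel (Rel.Ki_K (p := p))
lemma P_P : P p * P p = 1 := by simpa [P, pow_two] using mkOsp_rel (Rel.P_P (p := p))
lemma P_K : P p * K p = K p * P p := by simpa [K, P] using mkOsp_rel (Rel.P_K (p := p))
lemma P_Ki : P p * Ki p = Ki p * P p := by simpa [Ki, P] using mkOsp_rel (Rel.P_Ki (p := p))
lemma P_Ap : P p * Ap p = -(Ap p * P p) := by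
  rw [eq_neg_iff_add_eq_zero]; simpa [Ap, P] using mkOsp_rel (Rel.P_Ap (p := p))
lemma P_Am : P p * Am p = -(Am p * P p) := by
  rw [eq_neg_iff_add_eq_zero]; simpa [Am, P] using mkOsp_rel (Rel.P_Am (p := p))
lemma K_Ap : K p * Ap p = p.s • (Ap p * K p) := by
  have h : K p * Ap p * Ki p = p.s • Ap p := by
    simpa [K, Ki, Ap] using mkOsp_rel (Rel.K_Ap (p := p))
  rw [← smul_mul_assoc, ← h, mul_assoc _ (Ki p), Ki_K, mul_one]
lemma K_Am : K p * Am p = p.s⁻¹ • (Am p * K p) := by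
  have h : K p * Am p * Ki p = p.s⁻¹ • Am p := by
    simpa [K, Ki, Am] using mkOsp_rel (Rel.K_Am (p := p))
  rw [← smul_mul_assoc, ← h, mul_assoc _ (Ki p), Ki_K, mul_one]
lemma Ki_Ap : Ki p * Ap p = p.s⁻¹ • (Ap p * Ki p) := by
  have h : Ki p * (K p * Ap p) * Ki p = Ki p * (p.s • (Ap p * K p)) * Ki p := by rw [K_Ap]
  rw [← mul_assoc, Ki_K, one_mul, mul_smul_comm, smul_mul_assoc, mul_assoc, mul_assoc, K_Ki,
    mul_one] at h
  rw [h, inv_smul_smul₀ (s_ne_zero p)]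
lemma Ki_Am : Ki p * Am p = p.s • (Am p * Ki p) := by
  have h : Ki p * (K p * Am p) * Ki p = Ki p * (p.s⁻¹ • (Am p * K p)) * Ki p := by rw [K_Am]
  rw [← mul_assoc, Ki_K, one_mul, mul_smul_comm, smul_mul_assoc, mul_assoc, mul_assoc, K_Ki,
    mul_one] at h
  rw [h, smul_inv_smul₀ (s_ne_zero p)]
lemma Am_Ap : Am p * Ap p = -(Ap p * Am p)
    + (p.s - p.s⁻¹)⁻¹ • (K p * K p) - (p.s - p.s⁻¹)⁻¹ • (Ki p * Ki p) := by
  have h : Ap p * Am p + Am p * Ap p = (p.s - p.s⁻¹)⁻¹ • (K p * K p - Ki p * Ki p) := by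
    simpa [K, Ki, Am, Ap, pow_two] using mkOsp_rel (Rel.Ap_Am (p := p))
  rw [smul_sub] at h
  rw [add_sub_assoc, ← h]; abel

variable (x : Osp p)
lemma K_Ki' : K p * (Ki p * x) = x := by rw [← mul_assoc, K_Ki, one_mul]
lemma Ki_K' : Ki p * (K p * x) = x := by rw [← mul_assoc, Ki_K, one_mul]
lemma P_P' : P p * (P p * x) = x := by rw [← mul_assoc, P_P, one_mul]
lemma P_K' : P p * (K p * x) = K p * (P p * x) := by rw [← mul_assoc, P_K, mul_assoc]
lemma P_Ki' : P p * (Ki p * x) = Ki p * (P p * x) := by rw [← mul_assoc, P_Ki, mul_assoc]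
lemma P_Ap' : P p * (Ap p * x) = -(Ap p * (P p * x)) := by
  rw [← mul_assoc, P_Ap, neg_mul, mul_assoc]
lemma P_Am' : P p * (Am p * x) = -(Am p * (P p * x)) := by
  rw [← mul_assoc, P_Am, neg_mul, mul_assoc]
lemma K_Ap' : K p * (Ap p * x) = p.s • (Ap p * (K p * x)) := by
  rw [← mul_assoc, K_Ap, smul_mul_assoc, mul_assoc]
lemma K_Am' : K p * (Am p * x) = p.s⁻¹ • (Am p * (K p * x)) := by
  rw [← mul_assoc, K_Am, smul_mul_assoc, mul_assoc]
lemma Ki_Ap' : Ki p * (Ap p * x) = p.s⁻¹ • (Ap p * (Ki p * x)) := by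
  rw [← mul_assoc, Ki_Ap, smul_mul_assoc, mul_assoc]
lemma Ki_Am' : Ki p * (Am p * x) = p.s • (Am p * (Ki p * x)) := by
  rw [← mul_assoc, Ki_Am, smul_mul_assoc, mul_assoc]
lemma Am_Ap' : Am p * (Ap p * x) = -(Ap p * (Am p * x))
    + (p.s - p.s⁻¹)⁻¹ • (K p * (K p * x)) - (p.s - p.s⁻¹)⁻¹ • (Ki p * (Ki p * x)) := by
  rw [← mul_assoc, Am_Ap]; simp only [add_mul, sub_mul, neg_mul, smul_mul_assoc, mul_assoc]

end Relations

section Scalars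

lemma s_sub_ne : p.s - p.s⁻¹ ≠ 0 := by
  intro h
  have h0 := s_ne_zero p
  apply p.norm_q_ne_one
  have : p.s ^ 2 = 1 := by field_simp at h; linear_combination h
  rw [← p.s_sq, this]; simp

lemma q_pow_ne (n : ℕ) (hn : n ≠ 0) : p.q ^ n ≠ 1 ∧ p.q ^ n ≠ -1 := by
  have h : ‖p.q ^ n‖ ≠ 1 := by
    rw [norm_pow]
    intro h
    exact p.norm_q_ne_one ((pow_eq_one_iff_of_nonneg (norm_nonneg _) hn).1 h)
  constructor
  · intro h'; exact h (by rw [h']; simp)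
  · intro h'; exact h (by rw [h']; simp)

lemma q_sub_ne : p.q - p.q⁻¹ ≠ 0 := by
  intro h
  have h0 := p.q_ne_zero
  have : p.q ^ 2 = 1 := by field_simp at h; linear_combination h
  exact (q_pow_ne p 2 two_ne_zero).1 this

end Scalars

/-- The Casimir element
`Γ^q = (-A₊A₋ + (q^{-1/2} K² - q^{1/2} K⁻²) / (q - q⁻¹)) P`. -/
def Gam : Osp p :=
  (-(Ap p * Am p) + (p.q - p.q⁻¹)⁻¹ • (p.s⁻¹ • K p ^ 2 - p.s • Ki p ^ 2)) * P p

/-- The value of the coproduct on the generators. -/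
def comulGen : Gen → Osp p ⊗[ℂ] Osp p
  | .Ap => Ap p ⊗ₜ (K p * P p) + Ki p ⊗ₜ Ap p
  | .Am => Am p ⊗ₜ (K p * P p) + Ki p ⊗ₜ Am p
  | .K => K p ⊗ₜ K p
  | .Ki => Ki p ⊗ₜ Ki p
  | .P => P p ⊗ₜ P p

lemma comulGen_rel ⦃x y : FreeAlgebra ℂ Gen⦄ (h : Rel p x y) :
    FreeAlgebra.lift ℂ (comulGen p) x = FreeAlgebra.lift ℂ (comulGen p) y := by
  have h0 := s_ne_zero p
  cases h <;>
  simp only [map_mul, map_add, map_sub, map_pow, map_smul, map_one, map_zero,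
    FreeAlgebra.lift_ι_apply, comulGen, pow_two, Algebra.TensorProduct.one_def,
    mul_add, add_mul, Algebra.TensorProduct.tmul_mul_tmul, mul_assoc, K_Ki, Ki_K, P_P, P_K, P_Ki,
    P_Ap, P_Am, K_Ap, K_Am, Ki_Ap, Ki_Am, Am_Ap, K_Ki', Ki_K', P_P', P_K', P_Ki', P_Ap', P_Am',
    K_Ap', K_Am', Ki_Ap', Ki_Am', Am_Ap', mul_smul_comm, smul_mul_assoc, mul_neg, neg_mul,
    TensorProduct.tmul_smul, ← TensorProduct.smul_tmul', TensorProduct.tmul_neg,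
    TensorProduct.neg_tmul, TensorProduct.tmul_add, TensorProduct.tmul_sub,
    TensorProduct.add_tmul, TensorProduct.sub_tmul, smul_smul, mul_one, one_mul, smul_neg,
    mul_sub, sub_mul] <;>
  (try match_scalars) <;> (try field_simp) <;> (try ring_nf)

/-- The coproduct `Δ`. -/
def comul : Osp p →ₐ[ℂ] Osp p ⊗[ℂ] Osp p := liftOsp p (comulGen p) (comulGen_rel p)

lemma comul_Ap : comul p (Ap p) = Ap p ⊗ₜ (K p * P p) + Ki p ⊗ₜ Ap p := liftOsp_mk p _ _ _
lemma comul_Am : comul p (Am p) = Am p ⊗ₜ (K p * P p) + Ki p ⊗ₜ Am p := liftOsp_mk p _ _ _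
lemma comul_K : comul p (K p) = K p ⊗ₜ K p := liftOsp_mk p _ _ _
lemma comul_Ki : comul p (Ki p) = Ki p ⊗ₜ Ki p := liftOsp_mk p _ _ _
lemma comul_P : comul p (P p) = P p ⊗ₜ P p := liftOsp_mk p _ _ _

section Coideal

/-- Names for the generators `A₋K`, `A₊K`, `K²P` and `Γ^q` of the coideal subalgebra. -/
inductive CGen
  | m
  | a
  | k
  | g

/-- The elements `A₋K`, `A₊K`, `K²P` and `Γ^q`. -/
def cval : CGen → Osp p
  | .m => Am p * K p
  | .a => Ap p * K p
  | .k => K p ^ 2 * P p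
  | .g => Gam p

/-- The left coideal subalgebra `I` of `osp_q(1|2)` generated by `A₋K`, `A₊K`, `K²P`, `Γ^q`. -/
def coideal : Subalgebra ℂ (Osp p) := Algebra.adjoin ℂ (Set.range (cval p))

/-- The generators of `I`, as elements of `I`. -/
def cgen (i : CGen) : coideal p := ⟨cval p i, Algebra.subset_adjoin ⟨i, rfl⟩⟩

/-- The embedding of `osp_q(1|2) ⊗ I` in `osp_q(1|2) ⊗ osp_q(1|2)`. -/
def emb : Osp p ⊗[ℂ] coideal p →ₐ[ℂ] Osp p ⊗[ℂ] Osp p :=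
  Algebra.TensorProduct.map (AlgHom.id ℂ (Osp p)) (coideal p).val

lemma emb_tmul (x : Osp p) (y : coideal p) : emb p (x ⊗ₜ y) = x ⊗ₜ (y : Osp p) := rfl

lemma emb_injective : Function.Injective (emb p) :=
  Module.Flat.lTensor_preserves_injective_linearMap (M := Osp p) (coideal p).val.toLinearMap
    Subtype.val_injective

lemma comul_Gam : comul p (Gam p) = -(p.s • ((Am p * Ki p * P p) ⊗ₜ (Ap p * K p)))
    + p.s⁻¹ • ((Ap p * Ki p * P p) ⊗ₜ (Am p * K p))
    + ((p.s - p.s⁻¹) / (p.q - p.q⁻¹)) • ((Ki p ^ 2 * P p) ⊗ₜ (K p ^ 2 * P p))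
    + Gam p ⊗ₜ (K p ^ 2 * P p) + (Ki p ^ 2 * P p) ⊗ₜ Gam p := by
  have h0 := s_ne_zero p
  have h1 : p.s ^ 2 - 1 ≠ 0 := by
    have := (q_pow_ne p 1 one_ne_zero).1; rw [pow_one] at this; rw [p.s_sq]; exact sub_ne_zero.2 this
  have h2 : p.s ^ 2 + 1 ≠ 0 := by
    have := (q_pow_ne p 1 one_ne_zero).2; rw [pow_one] at this; rw [p.s_sq]
    intro h; exact this (eq_neg_of_add_eq_zero_left h)
  have h3 : p.s ^ 4 - 1 ≠ 0 := by
    have := (q_pow_ne p 2 two_ne_zero).1; rw [← p.s_sq, ← pow_mul] at this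
    exact sub_ne_zero.2 this
  simp only [Gam, comul_Ap, comul_Am, comul_K, comul_Ki, comul_P, map_mul, map_add, map_sub, map_neg, map_pow, map_smul, map_one, map_zero, pow_two,
    Algebra.TensorProduct.one_def, mul_add, add_mul, mul_sub, sub_mul,
    Algebra.TensorProduct.tmul_mul_tmul, mul_assoc, K_Ki, Ki_K, P_P, P_K, P_Ki,
    P_Ap, P_Am, K_Ap, K_Am, Ki_Ap, Ki_Am, Am_Ap, K_Ki', Ki_K', P_P', P_K', P_Ki', P_Ap', P_Am',
    K_Ap', K_Am', Ki_Ap', Ki_Am', Am_Ap', mul_smul_comm, smul_mul_assoc, mul_neg, neg_mul,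
    TensorProduct.tmul_smul, ← TensorProduct.smul_tmul', TensorProduct.tmul_neg,
    TensorProduct.neg_tmul, TensorProduct.tmul_add, TensorProduct.tmul_sub,
    TensorProduct.add_tmul, TensorProduct.sub_tmul, smul_smul, mul_one, one_mul, smul_neg,
    smul_add, smul_sub, ← p.s_sq]
  match_scalars <;> field_simp <;> ring_nf

lemma comul_mem (x : coideal p) : comul p x ∈ (emb p).range := by
  have hm (a : Osp p) (i : CGen) : a ⊗ₜ cval p i ∈ (emb p).range := ⟨a ⊗ₜ cgen p i, rfl⟩
  have h1 (a : Osp p) : a ⊗ₜ (1 : Osp p) ∈ (emb p).range := ⟨a ⊗ₜ 1, rfl⟩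
  have : coideal p ≤ (emb p).range.comap (comul p) := by
    refine Algebra.adjoin_le ?_
    rintro _ ⟨i, rfl⟩
    change comul p (cval p i) ∈ (emb p).range
    cases i with
    | m =>
      have : comul p (cval p .m) = (Am p * K p) ⊗ₜ cval p .k + 1 ⊗ₜ cval p .m := by
        simp only [cval, comul_Am, comul_K, map_mul, map_add, map_sub, map_neg, map_pow, map_smul, map_one, map_zero, pow_two,
    Algebra.TensorProduct.one_def, mul_add, add_mul, mul_sub, sub_mul,
    Algebra.TensorProduct.tmul_mul_tmul, mul_assoc, K_Ki, Ki_K, P_P, P_K, P_Ki,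
    P_Ap, P_Am, K_Ap, K_Am, Ki_Ap, Ki_Am, Am_Ap, K_Ki', Ki_K', P_P', P_K', P_Ki', P_Ap', P_Am',
    K_Ap', K_Am', Ki_Ap', Ki_Am', Am_Ap', mul_smul_comm, smul_mul_assoc, mul_neg, neg_mul,
    TensorProduct.tmul_smul, ← TensorProduct.smul_tmul', TensorProduct.tmul_neg,
    TensorProduct.neg_tmul, TensorProduct.tmul_add, TensorProduct.tmul_sub,
    TensorProduct.add_tmul, TensorProduct.sub_tmul, smul_smul, mul_one, one_mul, smul_neg,
    smul_add, smul_sub]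
      rw [this]
      exact add_mem (hm _ _) (hm _ _)
    | a =>
      have : comul p (cval p .a) = (Ap p * K p) ⊗ₜ cval p .k + 1 ⊗ₜ cval p .a := by
        simp only [cval, comul_Ap, comul_K, map_mul, map_add, map_sub, map_neg, map_pow, map_smul, map_one, map_zero, pow_two,
    Algebra.TensorProduct.one_def, mul_add, add_mul, mul_sub, sub_mul,
    Algebra.TensorProduct.tmul_mul_tmul, mul_assoc, K_Ki, Ki_K, P_P, P_K, P_Ki,
    P_Ap, P_Am, K_Ap, K_Am, Ki_Ap, Ki_Am, Am_Ap, K_Ki', Ki_K', P_P', P_K', P_Ki', P_Ap', P_Am',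
    K_Ap', K_Am', Ki_Ap', Ki_Am', Am_Ap', mul_smul_comm, smul_mul_assoc, mul_neg, neg_mul,
    TensorProduct.tmul_smul, ← TensorProduct.smul_tmul', TensorProduct.tmul_neg,
    TensorProduct.neg_tmul, TensorProduct.tmul_add, TensorProduct.tmul_sub,
    TensorProduct.add_tmul, TensorProduct.sub_tmul, smul_smul, mul_one, one_mul, smul_neg,
    smul_add, smul_sub]
      rw [this]
      exact add_mem (hm _ _) (hm _ _)
    | k =>
      have : comul p (cval p .k) = (K p ^ 2 * P p) ⊗ₜ cval p .k := by
        simp only [cval, comul_P, comul_K, map_mul, map_add, map_sub, map_neg, map_pow, map_smul, map_one, map_zero, pow_two,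
    Algebra.TensorProduct.one_def, mul_add, add_mul, mul_sub, sub_mul,
    Algebra.TensorProduct.tmul_mul_tmul, mul_assoc, K_Ki, Ki_K, P_P, P_K, P_Ki,
    P_Ap, P_Am, K_Ap, K_Am, Ki_Ap, Ki_Am, Am_Ap, K_Ki', Ki_K', P_P', P_K', P_Ki', P_Ap', P_Am',
    K_Ap', K_Am', Ki_Ap', Ki_Am', Am_Ap', mul_smul_comm, smul_mul_assoc, mul_neg, neg_mul,
    TensorProduct.tmul_smul, ← TensorProduct.smul_tmul', TensorProduct.tmul_neg,
    TensorProduct.neg_tmul, TensorProduct.tmul_add, TensorProduct.tmul_sub,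
    TensorProduct.add_tmul, TensorProduct.sub_tmul, smul_smul, mul_one, one_mul, smul_neg,
    smul_add, smul_sub]
      rw [this]
      exact hm _ _
    | g =>
      rw [show cval p .g = Gam p from rfl, comul_Gam]
      exact add_mem (add_mem (add_mem (add_mem (neg_mem (Subalgebra.smul_mem _ (hm _ .a) _))
        (Subalgebra.smul_mem _ (hm _ .m) _)) (Subalgebra.smul_mem _ (hm _ .k) _)) (hm _ .k))
        (hm _ .g)
  exact this x.2

/-- The coproduct as a map `I → osp_q(1|2) ⊗ I`. -/
def comulI : coideal p →ₐ[ℂ] Osp p ⊗[ℂ] coideal p :=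
  ((AlgEquiv.ofInjective (emb p) (emb_injective p)).symm : (emb p).range →ₐ[ℂ] _).comp
    (((comul p).comp (coideal p).val).codRestrict (emb p).range (comul_mem p))

lemma emb_comulI (x : coideal p) : emb p (comulI p x) = comul p x := by
  have h := AlgEquiv.apply_symm_apply (AlgEquiv.ofInjective (emb p) (emb_injective p))
    ⟨comul p x, comul_mem p x⟩
  exact congrArg Subtype.val h

end Coideal

section Tau

/-- The values of the coaction `τ` on the generators of `I`. -/
def tauGen : CGen → Osp p ⊗[ℂ] coideal p
  | .m => (K p ^ 2 * P p) ⊗ₜ cgen p .m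
  | .a => (Ki p ^ 2 * P p) ⊗ₜ cgen p .a
      + (p.s⁻¹ * (p.q - p.q⁻¹)) • ((Ap p ^ 2 * P p) ⊗ₜ cgen p .m)
      + (p.s⁻¹ * (p.s - p.s⁻¹)) • ((Ap p * Ki p * P p) ⊗ₜ cgen p .k)
      + (p.s⁻¹ * (p.q - p.q⁻¹)) • ((Ap p * Ki p * P p) ⊗ₜ cgen p .g)
  | .k => 1 ⊗ₜ cgen p .k - (p.q - p.q⁻¹) • ((Ap p * K p) ⊗ₜ cgen p .m)
  | .g => 1 ⊗ₜ cgen p .g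

/-! To see that these values extend to a morphism on `I`, a formal variable `t` is introduced which
records the degree in `A₊` of the first tensor factor.  The resulting assignment is then
conjugate, by a power series `θ`, to a restriction of a morphism `χ` that is
defined on all of `osp_q(1|2)`. -/

/-- The coefficients of `θ`, with `u = -q⁻¹`. -/
def thetaCoeff (u : ℂ) : ℕ → ℂ
  | 0 => 1
  | n + 1 => thetaCoeff u n * ((u - u⁻¹) * u ^ n / (u ^ (n + 1) - 1))

section Abstract

variable {R : Type} [Ring R] [Algebra ℂ R]

lemma skew_pow {x e : R} {z : ℂ} (h : e * x = z • (x * e)) (n : ℕ) :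
    e * x ^ n = z ^ n • (x ^ n * e) := by
  induction n with
  | zero => simp
  | succ n ih =>
    rw [pow_succ, ← mul_assoc, ih, smul_mul_assoc, mul_assoc, h, mul_smul_comm, smul_smul,
      ← mul_assoc, ← pow_succ]

lemma comm_pow {x a e f : R} {u κ : ℂ} (hx : x * a = a * x + κ • (e + f))
    (he : e * x = (u ^ 2) • (x * e)) (hf : f * x = u • (x * f)) (n : ℕ) :
    x ^ (n + 1) * a = a * x ^ (n + 1)
      + (κ * ∑ i ∈ Finset.range (n + 1), u ^ (2 * i)) • (x ^ n * e)
      + (κ * ∑ i ∈ Finset.range (n + 1), u ^ i) • (x ^ n * f) := by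
  induction n with
  | zero => simp [hx, add_assoc]
  | succ n ih =>
    have e1 := skew_pow he (n + 1)
    have f1 := skew_pow hf (n + 1)
    rw [pow_succ' x (n + 1), mul_assoc, ih, mul_add, mul_add, mul_smul_comm, mul_smul_comm,
      ← mul_assoc x a, hx, add_mul, smul_mul_assoc, add_mul, e1, f1, ← mul_assoc x (x ^ n),
      ← mul_assoc x (x ^ n), ← pow_succ', mul_assoc, ← pow_mul,
      Finset.sum_range_succ _ (n + 1), Finset.sum_range_succ _ (n + 1)]
    module

lemma theta_K {x k y : R} {u : ℂ} (hu : ∀ n : ℕ, u ^ (n + 1) ≠ 1)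
    (hk : k * x = u • (x * k)) (hy : y = x * k) (n : ℕ) :
    k * (thetaCoeff u (n + 1) • x ^ (n + 1)) + (-(u - u⁻¹)) • y * (thetaCoeff u n • x ^ n)
      = thetaCoeff u (n + 1) • x ^ (n + 1) * k := by
  have h := sub_ne_zero.2 (hu n)
  rw [mul_smul_comm, skew_pow hk, hy, smul_mul_assoc, mul_smul_comm, mul_assoc, skew_pow hk,
    mul_smul_comm, ← mul_assoc, ← pow_succ', smul_mul_assoc, thetaCoeff]
  match_scalars
  field_simp
  ring

lemma theta_A {x a e f : R} {u : ℂ} (hu0 : u ≠ 0) (hu : ∀ n : ℕ, u ^ (n + 1) ≠ 1)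
    (hu1 : u + 1 ≠ 0)
    (hx : x * a = a * x + (u / (u + 1)) • (e + f))
    (he : e * x = (u ^ 2) • (x * e)) (hf : f * x = u • (x * f)) (n : ℕ) :
    a * (thetaCoeff u (n + 2) • x ^ (n + 2)) + (e + f) * (thetaCoeff u (n + 1) • x ^ (n + 1))
      + ((1 - u) • (x * e)) * (thetaCoeff u n • x ^ n)
      = thetaCoeff u (n + 2) • x ^ (n + 2) * a := by
  have h1 := sub_ne_zero.2 (hu n)
  have h2 : u ^ (n + 2) - 1 ≠ 0 := sub_ne_zero.2 (hu (n + 1))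
  have h3 : u - 1 ≠ 0 := sub_ne_zero.2 (by simpa using hu 0)
  have h4 : u ^ 2 - 1 ≠ 0 := sub_ne_zero.2 (hu 1)
  rw [smul_mul_assoc, smul_mul_assoc, comm_pow hx he hf (n + 1), mul_smul_comm, mul_smul_comm, mul_smul_comm,
    add_mul, skew_pow he, skew_pow hf, mul_assoc x, skew_pow he, mul_smul_comm,
    ← mul_assoc x, ← pow_succ']
  simp only [pow_mul, geom_sum_eq (fun h => h3 (sub_eq_zero.2 h)),
    geom_sum_eq (fun h => h4 (sub_eq_zero.2 h)), thetaCoeff]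
  have h5 : u ^ (n + 1 + 1) - 1 ≠ 0 := h2
  match_scalars
  · field_simp
  · field_simp
    ring
  · field_simp
    ring

end Abstract

variable {p} in
lemma u_facts : -p.q⁻¹ ≠ 0 ∧ (∀ n : ℕ, (-p.q⁻¹) ^ (n + 1) ≠ 1) ∧ -p.q⁻¹ + 1 ≠ 0 := by
  have hq := p.q_ne_zero
  refine ⟨neg_ne_zero.2 (inv_ne_zero hq), fun n h => ?_, fun h => ?_⟩
  · have h' := congrArg norm h
    rw [norm_pow, norm_neg, norm_inv, norm_one, inv_pow, inv_eq_one, ← norm_pow] at h'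
    rw [norm_pow, pow_eq_one_iff_of_nonneg (norm_nonneg _) (Nat.succ_ne_zero n)] at h'
    exact p.norm_q_ne_one h'
  · have : p.q = 1 := by field_simp at h; linear_combination h
    exact p.norm_q_ne_one (by rw [this]; simp)

/-- The values of `χ` on the generators. -/
def chiGen : Gen → Osp p ⊗[ℂ] Osp p
  | .Ap => (Ki p ^ 2 * P p) ⊗ₜ Ap p
  | .Am => (K p ^ 2 * P p) ⊗ₜ Am p
  | .K => 1 ⊗ₜ K p
  | .Ki => 1 ⊗ₜ Ki p
  | .P => 1 ⊗ₜ P p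

lemma chiGen_rel ⦃x y : FreeAlgebra ℂ Gen⦄ (h : Rel p x y) :
    FreeAlgebra.lift ℂ (chiGen p) x = FreeAlgebra.lift ℂ (chiGen p) y := by
  have h0 := s_ne_zero p
  cases h <;>
  simp only [FreeAlgebra.lift_ι_apply, chiGen, map_mul, map_add, map_sub, map_neg, map_pow, map_smul, map_one, map_zero, pow_two,
    Algebra.TensorProduct.one_def, mul_add, add_mul, mul_sub, sub_mul,
    Algebra.TensorProduct.tmul_mul_tmul, mul_assoc, K_Ki, Ki_K, P_P, P_K, P_Ki,
    P_Ap, P_Am, K_Ap, K_Am, Ki_Ap, Ki_Am, Am_Ap, K_Ki', Ki_K', P_P', P_K', P_Ki', P_Ap', P_Am',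
    K_Ap', K_Am', Ki_Ap', Ki_Am', Am_Ap', mul_smul_comm, smul_mul_assoc, mul_neg, neg_mul,
    TensorProduct.tmul_smul, ← TensorProduct.smul_tmul', TensorProduct.tmul_neg,
    TensorProduct.neg_tmul, TensorProduct.tmul_add, TensorProduct.tmul_sub,
    TensorProduct.add_tmul, TensorProduct.sub_tmul, smul_smul, mul_one, one_mul, smul_neg,
    smul_add, smul_sub] <;>
  (try match_scalars) <;> (try field_simp) <;> (try ring_nf)

/-- The auxiliary morphism `χ`. -/
def chi : Osp p →ₐ[ℂ] Osp p ⊗[ℂ] Osp p := liftOsp p (chiGen p) (chiGen_rel p)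

lemma chi_Ap : chi p (Ap p) = (Ki p ^ 2 * P p) ⊗ₜ Ap p := liftOsp_mk p _ _ _
lemma chi_Am : chi p (Am p) = (K p ^ 2 * P p) ⊗ₜ Am p := liftOsp_mk p _ _ _
lemma chi_K : chi p (K p) = 1 ⊗ₜ K p := liftOsp_mk p _ _ _
lemma chi_Ki : chi p (Ki p) = 1 ⊗ₜ Ki p := liftOsp_mk p _ _ _
lemma chi_P : chi p (P p) = 1 ⊗ₜ P p := liftOsp_mk p _ _ _

/-- The argument of the power series `θ`. -/
def xel : Osp p ⊗[ℂ] Osp p := (Ap p * K p) ⊗ₜ (Am p * Ki p * P p)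

/-- The coefficients with respect to `t` of `τ` on the generators of `I`. -/
def tauCoeff : CGen → ℕ → Osp p ⊗[ℂ] Osp p
  | .m, 0 => (K p ^ 2 * P p) ⊗ₜ cval p .m
  | .a, 0 => (Ki p ^ 2 * P p) ⊗ₜ cval p .a
  | .a, 1 => (p.s⁻¹ * (p.s - p.s⁻¹)) • ((Ap p * Ki p * P p) ⊗ₜ cval p .k)
      + (p.s⁻¹ * (p.q - p.q⁻¹)) • ((Ap p * Ki p * P p) ⊗ₜ cval p .g)
  | .a, 2 => (p.s⁻¹ * (p.q - p.q⁻¹)) • ((Ap p ^ 2 * P p) ⊗ₜ cval p .m)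
  | .k, 0 => 1 ⊗ₜ cval p .k
  | .k, 1 => -((p.q - p.q⁻¹) • ((Ap p * K p) ⊗ₜ cval p .m))
  | .g, 0 => 1 ⊗ₜ cval p .g
  | _, _ => 0

open Polynomial in
/-- `τ` on the generators of `I`, with the formal variable `t` included. -/
def tauPoly (i : CGen) : (Osp p ⊗[ℂ] Osp p)[X] :=
  C (tauCoeff p i 0) + C (tauCoeff p i 1) * X + C (tauCoeff p i 2) * X ^ 2

/-- The morphism from the free algebra determined by `tauPoly`. -/
def tauHat : FreeAlgebra ℂ CGen →ₐ[ℂ] Polynomial (Osp p ⊗[ℂ] Osp p) :=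
  FreeAlgebra.lift ℂ (tauPoly p)

/-- The morphism from the free algebra determined by `tauGen`. -/
def tauFree : FreeAlgebra ℂ CGen →ₐ[ℂ] Osp p ⊗[ℂ] coideal p := FreeAlgebra.lift ℂ (tauGen p)

/-- The morphism from the free algebra onto `I`. -/
def genFree : FreeAlgebra ℂ CGen →ₐ[ℂ] coideal p := FreeAlgebra.lift ℂ (cgen p)

lemma genFree_surjective : Function.Surjective (genFree p) := by
  rintro ⟨x, hx⟩
  have hx' := hx
  rw [coideal, Algebra.adjoin_range_eq_range_freeAlgebra_lift] at hx'
  obtain ⟨w, hw⟩ := hx'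
  refine ⟨w, Subtype.ext ?_⟩
  have : (coideal p).val.comp (genFree p) = FreeAlgebra.lift ℂ (cval p) := by
    ext i; simp [genFree, cgen]
  exact (DFunLike.congr_fun this w).trans hw

/-- Setting `t = 1`. -/
def evalOne : Polynomial (Osp p ⊗[ℂ] Osp p) →ₐ[ℂ] Osp p ⊗[ℂ] Osp p :=
  Polynomial.eval₂AlgHom (AlgHom.id ℂ _) 1 (fun _ => Commute.one_right _)

lemma evalOne_tauHat (w : FreeAlgebra ℂ CGen) : evalOne p (tauHat p w) = emb p (tauFree p w) := by
  have : (evalOne p).comp (tauHat p) = (emb p).comp (tauFree p) := by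
    ext i
    simp only [AlgHom.comp_apply, Function.comp_apply, tauHat, tauFree, FreeAlgebra.lift_ι_apply,
      tauPoly, map_add, map_mul, map_pow]
    have hX : evalOne p Polynomial.X = 1 := by simp [evalOne]
    have hC (a) : evalOne p (Polynomial.C a) = a := by simp [evalOne]
    rw [hX, hC, hC, hC]
    cases i <;>
    simp only [tauCoeff, tauGen, map_add, map_sub, map_smul, map_neg, emb_tmul, cgen, mul_one,
      one_pow, add_zero, sub_eq_add_neg]
    abel
  exact DFunLike.congr_fun this w

/-- The power series `θ`. -/
def theta : PowerSeries (Osp p ⊗[ℂ] Osp p) :=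
  PowerSeries.mk fun n => thetaCoeff (-p.q⁻¹) n • xel p ^ n

lemma tau_intertwine_of {a0 a1 a2 b : Osp p ⊗[ℂ] Osp p} {g : ℕ → Osp p ⊗[ℂ] Osp p}
    (h0 : a0 * g 0 = g 0 * b) (h1 : a0 * g 1 + a1 * g 0 = g 1 * b)
    (h2 : ∀ n, a0 * g (n + 2) + a1 * g (n + 1) + a2 * g n = g (n + 2) * b) :
    ((Polynomial.C a0 + Polynomial.C a1 * Polynomial.X + Polynomial.C a2 * Polynomial.X ^ 2 :
      Polynomial (Osp p ⊗[ℂ] Osp p)) : PowerSeries (Osp p ⊗[ℂ] Osp p)) * PowerSeries.mk g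
      = PowerSeries.mk g * PowerSeries.C b := by
  ext n
  simp only [Polynomial.coe_add, Polynomial.coe_mul, Polynomial.coe_C, Polynomial.coe_X,
    Polynomial.coe_pow, add_mul, mul_assoc, map_add, PowerSeries.coeff_C_mul,
    PowerSeries.coeff_mul_C, PowerSeries.coeff_mk]
  match n with
  | 0 =>
    simpa [PowerSeries.coeff_X_pow_mul', PowerSeries.coeff_zero_X_mul] using h0
  | 1 =>
    have := PowerSeries.coeff_succ_X_mul 0 (PowerSeries.mk g)
    rw [zero_add] at this
    simpa [PowerSeries.coeff_X_pow_mul', this] using h1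
  | n + 2 =>
    simpa [PowerSeries.coeff_X_pow_mul', PowerSeries.coeff_succ_X_mul] using h2 n

section Checks

variable {p} in
lemma s_facts : p.s ≠ 0 ∧ p.s ^ 2 - 1 ≠ 0 ∧ p.s ^ 2 + 1 ≠ 0 ∧ p.s ^ 4 - 1 ≠ 0 := by
  refine ⟨s_ne_zero p, ?_, ?_, ?_⟩
  · have := (q_pow_ne p 1 one_ne_zero).1; rw [pow_one] at this; rw [p.s_sq]; exact sub_ne_zero.2 this
  · have := (q_pow_ne p 1 one_ne_zero).2; rw [pow_one] at this; rw [p.s_sq]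
    intro h; exact this (eq_neg_of_add_eq_zero_left h)
  · have := (q_pow_ne p 2 two_ne_zero).1; rw [← p.s_sq, ← pow_mul] at this
    exact sub_ne_zero.2 this

lemma check_m : ((K p ^ 2 * P p) ⊗ₜ cval p .m) * xel p = xel p * ((K p ^ 2 * P p) ⊗ₜ cval p .m) := by
  obtain ⟨h0, h1, h2, h3⟩ := s_facts (p := p)
  simp only [xel, cval, map_mul, map_add, map_sub, map_neg, map_pow, map_smul, map_one, map_zero, pow_two,
    Algebra.TensorProduct.one_def, mul_add, add_mul, mul_sub, sub_mul,
    Algebra.TensorProduct.tmul_mul_tmul, mul_assoc, K_Ki, Ki_K, P_P, P_K, P_Ki,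
    P_Ap, P_Am, K_Ap, K_Am, Ki_Ap, Ki_Am, Am_Ap, K_Ki', Ki_K', P_P', P_K', P_Ki', P_Ap', P_Am',
    K_Ap', K_Am', Ki_Ap', Ki_Am', Am_Ap', mul_smul_comm, smul_mul_assoc, mul_neg, neg_mul,
    TensorProduct.tmul_smul, ← TensorProduct.smul_tmul', TensorProduct.tmul_neg,
    TensorProduct.neg_tmul, TensorProduct.tmul_add, TensorProduct.tmul_sub,
    TensorProduct.add_tmul, TensorProduct.sub_tmul, smul_smul, mul_one, one_mul, smul_neg,
    smul_add, smul_sub]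
  match_scalars <;> field_simp

lemma check_g : (1 ⊗ₜ Gam p) * xel p = xel p * (1 ⊗ₜ Gam p) := by
  obtain ⟨h0, h1, h2, h3⟩ := s_facts (p := p)
  simp only [xel, Gam, map_mul, map_add, map_sub, map_neg, map_pow, map_smul, map_one, map_zero, pow_two,
    Algebra.TensorProduct.one_def, mul_add, add_mul, mul_sub, sub_mul,
    Algebra.TensorProduct.tmul_mul_tmul, mul_assoc, K_Ki, Ki_K, P_P, P_K, P_Ki,
    P_Ap, P_Am, K_Ap, K_Am, Ki_Ap, Ki_Am, Am_Ap, K_Ki', Ki_K', P_P', P_K', P_Ki', P_Ap', P_Am',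
    K_Ap', K_Am', Ki_Ap', Ki_Am', Am_Ap', mul_smul_comm, smul_mul_assoc, mul_neg, neg_mul,
    TensorProduct.tmul_smul, ← TensorProduct.smul_tmul', TensorProduct.tmul_neg,
    TensorProduct.neg_tmul, TensorProduct.tmul_add, TensorProduct.tmul_sub,
    TensorProduct.add_tmul, TensorProduct.sub_tmul, smul_smul, mul_one, one_mul, smul_neg,
    smul_add, smul_sub, ← p.s_sq]
  match_scalars <;> field_simp <;> ring_nf

lemma check_k : (1 ⊗ₜ cval p .k) * xel p = (-p.q⁻¹) • (xel p * (1 ⊗ₜ cval p .k)) := by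
  obtain ⟨h0, h1, h2, h3⟩ := s_facts (p := p)
  simp only [xel, cval, map_mul, map_add, map_sub, map_neg, map_pow, map_smul, map_one, map_zero, pow_two,
    Algebra.TensorProduct.one_def, mul_add, add_mul, mul_sub, sub_mul,
    Algebra.TensorProduct.tmul_mul_tmul, mul_assoc, K_Ki, Ki_K, P_P, P_K, P_Ki,
    P_Ap, P_Am, K_Ap, K_Am, Ki_Ap, Ki_Am, Am_Ap, K_Ki', Ki_K', P_P', P_K', P_Ki', P_Ap', P_Am',
    K_Ap', K_Am', Ki_Ap', Ki_Am', Am_Ap', mul_smul_comm, smul_mul_assoc, mul_neg, neg_mul,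
    TensorProduct.tmul_smul, ← TensorProduct.smul_tmul', TensorProduct.tmul_neg,
    TensorProduct.neg_tmul, TensorProduct.tmul_add, TensorProduct.tmul_sub,
    TensorProduct.add_tmul, TensorProduct.sub_tmul, smul_smul, mul_one, one_mul, smul_neg,
    smul_add, smul_sub, ← p.s_sq]
  match_scalars <;> field_simp

lemma check_k' : (Ap p * K p) ⊗ₜ cval p .m = xel p * (1 ⊗ₜ cval p .k) := by
  simp only [xel, cval, map_mul, map_add, map_sub, map_neg, map_pow, map_smul, map_one, map_zero, pow_two,
    Algebra.TensorProduct.one_def, mul_add, add_mul, mul_sub, sub_mul,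
    Algebra.TensorProduct.tmul_mul_tmul, mul_assoc, K_Ki, Ki_K, P_P, P_K, P_Ki,
    P_Ap, P_Am, K_Ap, K_Am, Ki_Ap, Ki_Am, Am_Ap, K_Ki', Ki_K', P_P', P_K', P_Ki', P_Ap', P_Am',
    K_Ap', K_Am', Ki_Ap', Ki_Am', Am_Ap', mul_smul_comm, smul_mul_assoc, mul_neg, neg_mul,
    TensorProduct.tmul_smul, ← TensorProduct.smul_tmul', TensorProduct.tmul_neg,
    TensorProduct.neg_tmul, TensorProduct.tmul_add, TensorProduct.tmul_sub,
    TensorProduct.add_tmul, TensorProduct.sub_tmul, smul_smul, mul_one, one_mul, smul_neg,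
    smul_add, smul_sub]

/-- The part of `tauCoeff p .a 1` involving `K²P`. -/
def eel : Osp p ⊗[ℂ] Osp p :=
  (p.s⁻¹ * (p.s - p.s⁻¹)) • ((Ap p * Ki p * P p) ⊗ₜ cval p .k)

/-- The part of `tauCoeff p .a 1` involving `Γ^q`. -/
def fel : Osp p ⊗[ℂ] Osp p :=
  (p.s⁻¹ * (p.q - p.q⁻¹)) • ((Ap p * Ki p * P p) ⊗ₜ cval p .g)

lemma check_e : eel p * xel p = ((-p.q⁻¹) ^ 2) • (xel p * eel p) := by
  obtain ⟨h0, h1, h2, h3⟩ := s_facts (p := p)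
  simp only [xel, eel, cval, map_mul, map_add, map_sub, map_neg, map_pow, map_smul, map_one, map_zero, pow_two,
    Algebra.TensorProduct.one_def, mul_add, add_mul, mul_sub, sub_mul,
    Algebra.TensorProduct.tmul_mul_tmul, mul_assoc, K_Ki, Ki_K, P_P, P_K, P_Ki,
    P_Ap, P_Am, K_Ap, K_Am, Ki_Ap, Ki_Am, Am_Ap, K_Ki', Ki_K', P_P', P_K', P_Ki', P_Ap', P_Am',
    K_Ap', K_Am', Ki_Ap', Ki_Am', Am_Ap', mul_smul_comm, smul_mul_assoc, mul_neg, neg_mul,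
    TensorProduct.tmul_smul, ← TensorProduct.smul_tmul', TensorProduct.tmul_neg,
    TensorProduct.neg_tmul, TensorProduct.tmul_add, TensorProduct.tmul_sub,
    TensorProduct.add_tmul, TensorProduct.sub_tmul, smul_smul, mul_one, one_mul, smul_neg,
    smul_add, smul_sub, ← p.s_sq]
  match_scalars <;> field_simp

lemma check_f : fel p * xel p = (-p.q⁻¹) • (xel p * fel p) := by
  obtain ⟨h0, h1, h2, h3⟩ := s_facts (p := p)
  simp only [xel, fel, cval, Gam, map_mul, map_add, map_sub, map_neg, map_pow, map_smul, map_one, map_zero, pow_two,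
    Algebra.TensorProduct.one_def, mul_add, add_mul, mul_sub, sub_mul,
    Algebra.TensorProduct.tmul_mul_tmul, mul_assoc, K_Ki, Ki_K, P_P, P_K, P_Ki,
    P_Ap, P_Am, K_Ap, K_Am, Ki_Ap, Ki_Am, Am_Ap, K_Ki', Ki_K', P_P', P_K', P_Ki', P_Ap', P_Am',
    K_Ap', K_Am', Ki_Ap', Ki_Am', Am_Ap', mul_smul_comm, smul_mul_assoc, mul_neg, neg_mul,
    TensorProduct.tmul_smul, ← TensorProduct.smul_tmul', TensorProduct.tmul_neg,
    TensorProduct.neg_tmul, TensorProduct.tmul_add, TensorProduct.tmul_sub,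
    TensorProduct.add_tmul, TensorProduct.sub_tmul, smul_smul, mul_one, one_mul, smul_neg,
    smul_add, smul_sub, ← p.s_sq]
  match_scalars <;> field_simp <;> ring_nf

lemma check_a : xel p * ((Ki p ^ 2 * P p) ⊗ₜ cval p .a) = ((Ki p ^ 2 * P p) ⊗ₜ cval p .a) * xel p
    + (-p.q⁻¹ / (-p.q⁻¹ + 1)) • (eel p + fel p) := by
  obtain ⟨h0, h1, h2, h3⟩ := s_facts (p := p)
  have h4 : -(p.s ^ 2)⁻¹ + 1 ≠ 0 := by
    have := u_facts (p := p); rw [p.s_sq]; exact this.2.2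
  have h5 : -(p.s ^ 2)⁻¹ / (-(p.s ^ 2)⁻¹ + 1) = -(p.s ^ 2 - 1)⁻¹ := by
    rw [div_eq_iff h4]; field_simp; ring
  rw [← p.s_sq, h5]
  simp only [xel, eel, fel, cval, Gam, map_mul, map_add, map_sub, map_neg, map_pow, map_smul, map_one, map_zero, pow_two,
    Algebra.TensorProduct.one_def, mul_add, add_mul, mul_sub, sub_mul,
    Algebra.TensorProduct.tmul_mul_tmul, mul_assoc, K_Ki, Ki_K, P_P, P_K, P_Ki,
    P_Ap, P_Am, K_Ap, K_Am, Ki_Ap, Ki_Am, Am_Ap, K_Ki', Ki_K', P_P', P_K', P_Ki', P_Ap', P_Am',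
    K_Ap', K_Am', Ki_Ap', Ki_Am', Am_Ap', mul_smul_comm, smul_mul_assoc, mul_neg, neg_mul,
    TensorProduct.tmul_smul, ← TensorProduct.smul_tmul', TensorProduct.tmul_neg,
    TensorProduct.neg_tmul, TensorProduct.tmul_add, TensorProduct.tmul_sub,
    TensorProduct.add_tmul, TensorProduct.sub_tmul, smul_smul, mul_one, one_mul, smul_neg,
    smul_add, smul_sub, ← p.s_sq]
  match_scalars <;> field_simp <;> ring_nf

lemma check_a2 : tauCoeff p .a 2 = (1 - -p.q⁻¹) • (xel p * eel p) := by
  obtain ⟨h0, h1, h2, h3⟩ := s_facts (p := p)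
  simp only [tauCoeff, xel, eel, cval, map_mul, map_add, map_sub, map_neg, map_pow, map_smul, map_one, map_zero, pow_two,
    Algebra.TensorProduct.one_def, mul_add, add_mul, mul_sub, sub_mul,
    Algebra.TensorProduct.tmul_mul_tmul, mul_assoc, K_Ki, Ki_K, P_P, P_K, P_Ki,
    P_Ap, P_Am, K_Ap, K_Am, Ki_Ap, Ki_Am, Am_Ap, K_Ki', Ki_K', P_P', P_K', P_Ki', P_Ap', P_Am',
    K_Ap', K_Am', Ki_Ap', Ki_Am', Am_Ap', mul_smul_comm, smul_mul_assoc, mul_neg, neg_mul,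
    TensorProduct.tmul_smul, ← TensorProduct.smul_tmul', TensorProduct.tmul_neg,
    TensorProduct.neg_tmul, TensorProduct.tmul_add, TensorProduct.tmul_sub,
    TensorProduct.add_tmul, TensorProduct.sub_tmul, smul_smul, mul_one, one_mul, smul_neg,
    smul_add, smul_sub, ← p.s_sq]
  match_scalars <;> field_simp <;> ring_nf

lemma check_m_pow (n : ℕ) : ((K p ^ 2 * P p) ⊗ₜ cval p .m) * xel p ^ n
    = xel p ^ n * ((K p ^ 2 * P p) ⊗ₜ cval p .m) :=
  (show Commute _ _ from check_m p).pow_right n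

lemma check_g_pow (n : ℕ) : (1 ⊗ₜ Gam p) * xel p ^ n = xel p ^ n * (1 ⊗ₜ Gam p) :=
  (show Commute _ _ from check_g p).pow_right n

lemma chi_cval (i : CGen) : chi p (cgen p i) = tauCoeff p i 0 := by
  cases i <;>
  simp only [cgen, cval, tauCoeff, Gam, chi_Ap, chi_Am, chi_K, chi_Ki, chi_P, map_mul, map_add, map_sub, map_neg, map_pow, map_smul, map_one, map_zero, pow_two,
    Algebra.TensorProduct.one_def, mul_add, add_mul, mul_sub, sub_mul,
    Algebra.TensorProduct.tmul_mul_tmul, mul_assoc, K_Ki, Ki_K, P_P, P_K, P_Ki,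
    P_Ap, P_Am, K_Ap, K_Am, Ki_Ap, Ki_Am, Am_Ap, K_Ki', Ki_K', P_P', P_K', P_Ki', P_Ap', P_Am',
    K_Ap', K_Am', Ki_Ap', Ki_Am', Am_Ap', mul_smul_comm, smul_mul_assoc, mul_neg, neg_mul,
    TensorProduct.tmul_smul, ← TensorProduct.smul_tmul', TensorProduct.tmul_neg,
    TensorProduct.neg_tmul, TensorProduct.tmul_add, TensorProduct.tmul_sub,
    TensorProduct.add_tmul, TensorProduct.sub_tmul, smul_smul, mul_one, one_mul, smul_neg,
    smul_add, smul_sub]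

end Checks

lemma tau_intertwine (w : FreeAlgebra ℂ CGen) :
    (tauHat p w : PowerSeries (Osp p ⊗[ℂ] Osp p)) * theta p
      = theta p * PowerSeries.C (chi p (genFree p w)) := by
  obtain ⟨u0, u1, u2⟩ := u_facts (p := p)
  have hu : -p.q⁻¹ - (-p.q⁻¹)⁻¹ = p.q - p.q⁻¹ := by rw [inv_neg, inv_inv]; ring
  induction w using FreeAlgebra.induction with
  | grade0 r =>
    rw [AlgHom.commutes, AlgHom.commutes, Subalgebra.coe_algebraMap, AlgHom.commutes,
      Polynomial.algebraMap_apply, Polynomial.coe_C]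
    ext n
    rw [PowerSeries.coeff_C_mul, PowerSeries.coeff_mul_C, Algebra.commutes]
  | add a b ha hb =>
    simp only [map_add, Polynomial.coe_add, add_mul, ha, hb, Subalgebra.coe_add, mul_add]
  | mul a b ha hb =>
    rw [map_mul, Polynomial.coe_mul, mul_assoc, hb, ← mul_assoc, ha, mul_assoc, ← map_mul,
      ← map_mul, map_mul (genFree p), Subalgebra.coe_mul]
  | grade1 i =>
    rw [tauHat, FreeAlgebra.lift_ι_apply, genFree, FreeAlgebra.lift_ι_apply, tauPoly, theta,
      chi_cval]
    apply tau_intertwine_of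
    · simp [thetaCoeff]
    · cases i with
      | m =>
        simp only [tauCoeff, zero_mul, add_zero, mul_smul_comm, smul_mul_assoc, smul_zero]
        rw [check_m_pow]
      | g =>
        simp only [tauCoeff, cval, zero_mul, add_zero, mul_smul_comm, smul_mul_assoc, smul_zero]
        rw [check_g_pow]
      | k =>
        have := theta_K u1 (check_k p) (check_k' p) 0
        rw [hu, neg_smul] at this
        simpa [tauCoeff, thetaCoeff] using this
      | a =>
        have h := check_a p
        have h1 : thetaCoeff (-p.q⁻¹) 1 * (-p.q⁻¹ / (-p.q⁻¹ + 1)) = 1 := by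
          have h2 := sub_ne_zero.2 (u1 0)
          simp only [thetaCoeff]
          generalize -p.q⁻¹ = u at *
          rw [zero_add, pow_one] at *
          field_simp
          ring
        simp only [zero_add, pow_one, pow_zero, smul_mul_assoc, mul_smul_comm]
        change _ + thetaCoeff _ 0 • ((eel p + fel p) * 1)
          = _ • (xel p * ((Ki p ^ 2 * P p) ⊗ₜ cval p .a))
        rw [check_a, smul_add, smul_smul, h1]
        simp [thetaCoeff, tauCoeff]
    · intro n
      cases i with
      | m =>
        simp only [tauCoeff, zero_mul, add_zero, mul_smul_comm, smul_mul_assoc, smul_zero]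
        rw [check_m_pow]
      | g =>
        simp only [tauCoeff, cval, zero_mul, add_zero, mul_smul_comm, smul_mul_assoc, smul_zero]
        rw [check_g_pow]
      | k =>
        have := theta_K u1 (check_k p) (check_k' p) (n + 1)
        rw [hu, neg_smul] at this
        simpa [tauCoeff] using this
      | a =>
        rw [check_a2]
        exact theta_A u0 u1 u2 (check_a p) (check_e p) (check_f p) n

lemma tauFree_eq_zero {w : FreeAlgebra ℂ CGen} (hw : genFree p w = 0) : tauFree p w = 0 := by
  apply emb_injective p
  have h := tau_intertwine p w
  rw [hw, ZeroMemClass.coe_zero, map_zero, map_zero, mul_zero] at h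
  have key (n : ℕ) : (tauHat p w).coeff n = 0 := by
    induction n using Nat.strong_induction_on with
    | _ n ih =>
      have hn := congrArg (PowerSeries.coeff n) h
      rw [PowerSeries.coeff_mul, map_zero, Finset.sum_eq_single (n, 0)] at hn
      · simpa [theta, thetaCoeff] using hn
      · rintro ⟨i, j⟩ hij hne
        rw [Finset.HasAntidiagonal.mem_antidiagonal] at hij
        have hi : i < n := by
          rcases Nat.lt_or_ge i n with h1 | h1
          · exact h1
          · exact absurd (Prod.ext (by simp at hij ⊢; omega) (by simp at hij ⊢; omega)) hne
        rw [Polynomial.coeff_coe, ih i hi, zero_mul]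
      · intro h1; exact absurd (Finset.HasAntidiagonal.mem_antidiagonal.2 (by simp)) h1
  have hz : tauHat p w = 0 := Polynomial.ext (by simpa using key)
  rw [← evalOne_tauHat, hz, map_zero, map_zero]

/-- The coaction `τ : I → osp_q(1|2) ⊗ I`: the algebra morphism with the values `tauGen` on the
generators of `I`. -/
def tau : coideal p →ₐ[ℂ] Osp p ⊗[ℂ] coideal p :=
  have key (w v : FreeAlgebra ℂ CGen) (h : genFree p w = genFree p v) :
      tauFree p w = tauFree p v := by
    rw [← sub_eq_zero, ← map_sub]
    exact tauFree_eq_zero p (by rw [map_sub, h, sub_self])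
  have hs := Function.surjInv_eq (genFree_surjective p)
  { toFun := fun y => tauFree p (Function.surjInv (genFree_surjective p) y)
    map_one' := (key _ 1 (by rw [hs, map_one])).trans (map_one _)
    map_mul' := fun x y => (key _ (_ * _) (by rw [hs, map_mul, hs, hs])).trans (map_mul _ _ _)
    map_zero' := (key _ 0 (by rw [hs, map_zero])).trans (map_zero _)
    map_add' := fun x y => (key _ (_ + _) (by rw [hs, map_add, hs, hs])).trans (map_add _ _ _)
    commutes' := fun r => (key _ (algebraMap ℂ _ r) (by rw [hs, AlgHom.commutes])).trans
      (AlgHom.commutes _ _) }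

lemma tau_cgen (i : CGen) : tau p (cgen p i) = tauGen p i := by
  have h : genFree p (Function.surjInv (genFree_surjective p) (cgen p i))
      = genFree p (FreeAlgebra.ι ℂ i) := by
    rw [Function.surjInv_eq (genFree_surjective p)]; simp [genFree]
  have h2 : tauFree p (Function.surjInv (genFree_surjective p) (cgen p i))
      = tauFree p (FreeAlgebra.ι ℂ i) := by
    rw [← sub_eq_zero, ← map_sub]
    exact tauFree_eq_zero p (by rw [map_sub, h, sub_self])
  exact h2.trans (by simp [tauFree])

end Tau

section Gamma

open PiTensorProduct (liftAlgHom singleAlgHom singleAlgHom_apply tprod_mul_tprod)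

/-- The `n`-fold tensor product algebra `osp_q(1|2)^{⊗ n}`. -/
abbrev Pow (n : ℕ) : Type := ⨂[ℂ] _ : Fin n, Osp p

/-- `x ↦ 1 ⊗ x`, as a morphism `osp_q(1|2)^{⊗ n} → osp_q(1|2)^{⊗ (n + 1)}`. -/
def shift (n : ℕ) : Pow p n →ₐ[ℂ] Pow p (n + 1) :=
  liftAlgHom
    { toFun := fun f => PiTensorProduct.tprod ℂ (Fin.cons 1 f : Fin (n + 1) → Osp p)
      map_update_add' := fun f i x y => by
        have (inst : DecidableEq (Fin n)) (z : Osp p) :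
            (Fin.cons 1 (@Function.update _ _ inst f i z) : Fin (n + 1) → Osp p)
              = Function.update (Fin.cons 1 f) i.succ z := by
          rw [Subsingleton.elim inst (instDecidableEqFin n)]
          exact Fin.cons_update (α := fun _ => Osp p) 1 f i z
        rw [this, this, this, MultilinearMap.map_update_add]
      map_update_smul' := fun f i c x => by
        have (inst : DecidableEq (Fin n)) (z : Osp p) :
            (Fin.cons 1 (@Function.update _ _ inst f i z) : Fin (n + 1) → Osp p)
              = Function.update (Fin.cons 1 f) i.succ z := by
          rw [Subsingleton.elim inst (instDecidableEqFin n)]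
          exact Fin.cons_update (α := fun _ => Osp p) 1 f i z
        rw [this, this, MultilinearMap.map_update_smul] }
    (congrArg (PiTensorProduct.tprod ℂ) (funext fun i => by cases i using Fin.cases <;> rfl))
    (fun f g => by
      change PiTensorProduct.tprod ℂ _ = PiTensorProduct.tprod ℂ _ * PiTensorProduct.tprod ℂ _
      rw [tprod_mul_tprod]
      exact congrArg (PiTensorProduct.tprod ℂ) (funext fun i => by
        cases i using Fin.cases <;> simp))

lemma shift_tprod (n : ℕ) (f : Fin n → Osp p) :
    shift p n (PiTensorProduct.tprod ℂ f) = PiTensorProduct.tprod ℂ (Fin.cons 1 f : Fin (n + 1) → Osp p) := by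
  simp [shift]

lemma commute_shift (n : ℕ) (a : Osp p) (x : Pow p n) :
    Commute (singleAlgHom (R := ℂ) (A := fun _ : Fin (n + 1) => Osp p) 0 a) (shift p n x) := by
  induction x using PiTensorProduct.induction_on with
  | smul_tprod r f =>
    rw [map_smul, shift_tprod]
    refine Commute.smul_right ?_ r
    refine Commute.tprod (Pi.commute_iff.2 fun i => ?_)
    cases i using Fin.cases <;> simp
  | add x y hx hy => rw [map_add]; exact hx.add_right hy

/-- The canonical identification of `osp_q(1|2) ⊗ osp_q(1|2)^{⊗ n}` with
`osp_q(1|2)^{⊗ (n + 1)}`. -/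
def cons (n : ℕ) : Osp p ⊗[ℂ] Pow p n →ₐ[ℂ] Pow p (n + 1) :=
  Algebra.TensorProduct.lift (singleAlgHom (R := ℂ) (A := fun _ : Fin (n + 1) => Osp p) 0) (shift p n) (commute_shift p n)

lemma cons_tmul_tprod (n : ℕ) (a : Osp p) (f : Fin n → Osp p) :
    cons p n (a ⊗ₜ PiTensorProduct.tprod ℂ f) = PiTensorProduct.tprod ℂ (Fin.cons a f : Fin (n + 1) → Osp p) := by
  rw [cons, Algebra.TensorProduct.lift_tmul, shift_tprod, singleAlgHom_apply, tprod_mul_tprod]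
  refine congrArg (PiTensorProduct.tprod ℂ) (funext fun i => ?_)
  cases i using Fin.cases <;> simp

/-- The tensor factors on which the extension process still has to act after the index `k` has been
treated: only the last factor, an element of `I`, if `k ∈ A`; the last two factors, the hole at
position `k` and the element of `I` at position `k + 1`, if `k ∉ A`. -/
def Tail : Bool → Type
  | true => coideal p
  | false => Osp p ⊗[ℂ] coideal p

instance : (b : Bool) → Ring (Tail p b)
  | true => inferInstanceAs (Ring (coideal p))
  | false => inferInstanceAs (Ring (Osp p ⊗[ℂ] coideal p))

instance : (b : Bool) → Algebra ℂ (Tail p b)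
  | true => inferInstanceAs (Algebra ℂ (coideal p))
  | false => inferInstanceAs (Algebra ℂ (Osp p ⊗[ℂ] coideal p))

/-- The extension morphism `τ_{k-1,k}^A`, acting on the last tensor factors only; the first
Boolean says whether `k - 1 ∈ A`, the second one whether `k ∈ A`. In each case precisely one
additional tensor factor is split off which later extension morphisms do not act upon. -/
def extStep : (b b' : Bool) → Tail p b →ₐ[ℂ] Osp p ⊗[ℂ] Tail p b'
  | true, true => comulI p
  | true, false => (Algebra.TensorProduct.map (AlgHom.id ℂ (Osp p)) (tau p)).comp (comulI p)
  | false, false =>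
      (Algebra.TensorProduct.assoc ℂ ℂ ℂ (Osp p) (Osp p) (coideal p) :
        (Osp p ⊗[ℂ] Osp p) ⊗[ℂ] coideal p →ₐ[ℂ] Osp p ⊗[ℂ] (Osp p ⊗[ℂ] coideal p)).comp
      (Algebra.TensorProduct.map (comul p) (AlgHom.id ℂ (coideal p)))
  | false, true => AlgHom.id ℂ (Osp p ⊗[ℂ] coideal p)

/-- The embedding `x ↦ x ⊗ 1 ⊗ ⋯ ⊗ 1` (with `r` factors `1`) of the last factor, used once
the largest element of `A` has been reached. -/
def close (r : ℕ) : (b : Bool) → b = true → (Tail p b →ₐ[ℂ] Pow p (r + 1))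
  | true, _ =>
      ((cons p r).comp Algebra.TensorProduct.includeLeft).comp (coideal p).val

/-- The extension morphisms `τ_{j-1,j}^A` for `j = k + 1, …, max A`, applied in order of
increasing `j` to the factors which are present after the index `k` has been treated, followed by
the insertion of units at the positions from `max A + 1` to `k + r`. The result is the part of
the tensor product with positions `k, …, k + r`. The hypothesis says `k ≤ max A ≤ k + r`. -/
def ext (A : Finset ℕ) : (r k : ℕ) → (∃ j ∈ A, k ≤ j ∧ j ≤ k + r) →
    (Tail p (decide (k ∈ A)) →ₐ[ℂ] Pow p (r + 1))
  | 0, k, h => close p 0 _ (by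
      obtain ⟨j, hj, h1, h2⟩ := h
      have : j = k := by omega
      simpa [this] using hj)
  | r + 1, k, h =>
    if h' : ∃ j ∈ A, k + 1 ≤ j ∧ j ≤ k + 1 + r then
      (cons p (r + 1)).comp
        ((Algebra.TensorProduct.map (AlgHom.id ℂ (Osp p)) (ext A r (k + 1) h')).comp
          (extStep p (decide (k ∈ A)) (decide (k + 1 ∈ A))))
    else close p (r + 1) _ (by
      obtain ⟨j, hj, h1, h2⟩ := h
      have : j = k := by
        by_contra hne
        exact h' ⟨j, hj, by omega, by omega⟩
      simpa [this] using hj)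

/-- `Γ^q` as an element of the last tensor factor at the start of the extension process. -/
def startGam : (b : Bool) → b = true → Tail p b
  | true, _ => cgen p .g

/-- The part of `Γ_A^q` with positions `k, …, k + n - 1`, when `A` has no elements below `k`:
units are inserted at the positions below `min A`, and at `min A` the extension process starts
from `Γ^q`. If `A` has no elements in this range the result is the scalar `-[1/2]_q`. -/
def gammaFrom (A : Finset ℕ) : (n k : ℕ) → Pow p n
  | 0, _ => -((p.s - p.s⁻¹) / (p.q - p.q⁻¹)) • 1
  | n + 1, k =>
    if h : k ∈ A then
      ext p A n k ⟨k, h, le_rfl, Nat.le_add_right k n⟩ (startGam p _ (by simpa using h))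
    else shift p n (gammaFrom A n (k + 1))

/-- The element `Γ_A^q` of `osp_q(1|2)^{⊗ n}`, for `A ⊆ {1, …, n}`. -/
def Gamma (n : ℕ) (A : Finset ℕ) : Pow p n := gammaFrom p A n 1

/-- The higher rank `q`-Bannai-Ito algebra `𝒜_n^q`: the subalgebra of `osp_q(1|2)^{⊗ n}`
generated by the elements `Γ_A^q` with `A ⊆ {1, …, n}`. -/
def qBannaiIto (n : ℕ) : Subalgebra ℂ (Pow p n) :=
  Algebra.adjoin ℂ {x | ∃ A ⊆ Finset.Icc 1 n, x = Gamma p n A}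

end Gamma

end QBannaiIto

end

open scoped TensorProduct

noncomputable section

namespace QBannaiIto

variable (p : Parameter)

/-! Write U for osp_q(1|2) and I for the coideal subalgebra. Everything rests on one identity in U ⊗
U ⊗ I, s Γ₁₂Γ₂₃ + s⁻¹ Γ₂₃Γ₁₂ = Γ₁₃ + (s + s⁻¹)(Γ₂Γ₁₂₃ + Γ₁Γ₃), which expresses Γ₁₃, the only term
whose index set has a gap, through elements indexed by intervals (`rank_three_relation`).

The elements Γ₁₂, Γ₁₃ and Γ₁₂₃ arise by applying 1 ⊗ f to Δ(Γ), where f is b ↦ b ⊗ 1, τ or Δ. Hence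
the identity amounts to evaluating 1 ⊗ `defect` on Δ(Γ). The defect is linear in b, and the second
legs of Δ(Γ) are the four generators of I, so only four values are needed; each is a multiple of 1 ⊗
Γ (`defect_cgen`).

For a general A with a gap, containing the first position k of the window, split the window into the
first block of A, the first hole, and the rest. An algebra morphism G from U ⊗ U ⊗ I spreads the
first factor over the block and the second over the hole by iterated coproducts, and sends the third
through the remaining extension steps. Coassociativity shows that G carries the seven elements above
to the Γ of the corresponding unions of block, hole and rest, with Γ₁₃ ↦ Γ_A (`gammaFrom_relation`).

Generation follows by induction on the number of tensor factors and, inside it, on the number of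
points of the window missing from A. Block, hole and block ∪ hole are intervals; the two sets
without the block avoid k and come from fewer factors; A ∪ hole misses fewer points. -/

/-! ### The defect on the generators of I -/

/-- The defect of `b` in the relation
`s (b ⊗ 1) Δ(Γ) + s⁻¹ Δ(Γ) (b ⊗ 1) = τ(b) + (s + s⁻¹) (Γ ⊗ 1) Δ(b)`. -/
def defect (b : coideal p) : Osp p ⊗[ℂ] coideal p :=
  p.s • (((b : Osp p) ⊗ₜ 1) * comulI p (cgen p .g))
    + p.s⁻¹ • (comulI p (cgen p .g) * ((b : Osp p) ⊗ₜ 1))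
    - tau p b - (p.s + p.s⁻¹) • ((Gam p ⊗ₜ 1) * comulI p b)

lemma emb_defect (b : coideal p) : emb p (defect p b) =
    p.s • (((b : Osp p) ⊗ₜ 1) * comul p (Gam p))
    + p.s⁻¹ • (comul p (Gam p) * ((b : Osp p) ⊗ₜ 1))
    - emb p (tau p b) - (p.s + p.s⁻¹) • ((Gam p ⊗ₜ 1) * comul p b) := by
  simp only [defect, map_sub, map_add, map_smul, map_mul, emb_tmul, emb_comulI, cgen, cval,
    Subalgebra.coe_one]

/-- The scalars `c` with `defect p b = c • (1 ⊗ Γ)` for the generators `b` of `I`. -/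
def defectCoeff : CGen → ℂ
  | .m => 0
  | .a => 0
  | .k => p.s + p.s⁻¹
  | .g => -((p.s - p.s⁻¹) / (p.q - p.q⁻¹)) * (p.s + p.s⁻¹)

lemma defect_cgen (i : CGen) : defect p (cgen p i) = defectCoeff p i • (1 ⊗ₜ cgen p .g) := by
  obtain ⟨h0, h1, h2, h3⟩ := s_facts (p := p)
  apply emb_injective p
  rw [emb_defect, tau_cgen]
  cases i <;>
  simp only [defectCoeff, tauGen, cgen, cval, comul_Gam, map_mul, map_add, map_sub, map_neg,
    map_pow, map_smul, map_one, map_zero, emb_tmul, comul_Ap, comul_Am, comul_K, comul_P] <;>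
  -- In each tensor factor monomials are brought to normal order: A₊ before A₋ before K^{±1}, with P
  -- last. With q replaced by s², it remains to compare coefficients, which are rational functions
  -- of s.
  simp only [Gam, pow_two,
    Algebra.TensorProduct.one_def, mul_add, add_mul, mul_sub, sub_mul,
    Algebra.TensorProduct.tmul_mul_tmul, mul_assoc, K_Ki, Ki_K, P_P, P_K, P_Ki,
    P_Ap, P_Am, K_Ap, K_Am, Ki_Ap, Ki_Am, Am_Ap, K_Ki', Ki_K', P_P', P_K', P_Ki', P_Ap', P_Am',
    K_Ap', K_Am', Ki_Ap', Ki_Am', Am_Ap', mul_smul_comm, smul_mul_assoc, mul_neg, neg_mul,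
    TensorProduct.tmul_smul, ← TensorProduct.smul_tmul', TensorProduct.tmul_neg,
    TensorProduct.neg_tmul, TensorProduct.tmul_add, TensorProduct.tmul_sub,
    TensorProduct.add_tmul, TensorProduct.sub_tmul, smul_smul, mul_one, one_mul, smul_neg,
    smul_add, smul_sub, ← p.s_sq] <;>
  match_scalars <;> field_simp <;> ring_nf

/-- The embedding `x ↦ x ⊗ 1` in `osp_q(1|2) ⊗ B`. -/
abbrev inL (B : Type) [Ring B] [Algebra ℂ B] : Osp p →ₐ[ℂ] Osp p ⊗[ℂ] B :=
  Algebra.TensorProduct.includeLeft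

/-- The embedding `y ↦ 1 ⊗ y` in `osp_q(1|2) ⊗ B`. -/
abbrev inR (B : Type) [Ring B] [Algebra ℂ B] : B →ₐ[ℂ] Osp p ⊗[ℂ] B :=
  Algebra.TensorProduct.includeRight

/-! ### The rank three relation -/

section RankThree

open Algebra.TensorProduct (map)

/-- `defect` as a linear map. -/
def defectLin : coideal p →ₗ[ℂ] Osp p ⊗[ℂ] coideal p where
  toFun := defect p
  map_add' x y := by
    simp only [defect, Subalgebra.coe_add, TensorProduct.add_tmul, add_mul, mul_add, map_add]
    module
  map_smul' c x := by
    simp only [defect, Subalgebra.coe_smul, ← TensorProduct.smul_tmul', smul_mul_assoc,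
      mul_smul_comm, map_smul, RingHom.id_apply]
    module

/-- The embedding `x ↦ x ⊗ 1` of `I` in `osp_q(1|2) ⊗ B`. -/
def inclLeft (B : Type) [Ring B] [Algebra ℂ B] : coideal p →ₐ[ℂ] Osp p ⊗[ℂ] B :=
  (inL p B).comp (coideal p).val

lemma inclLeft_apply (B : Type) [Ring B] [Algebra ℂ B] (x : coideal p) :
    inclLeft p B x = (x : Osp p) ⊗ₜ 1 := rfl

/-- The point is that the second legs are single generators of I, not products: the defect is linear
but not multiplicative, so its values on generators suffice only because of this. -/
lemma comulI_Gam : comulI p (cgen p .g) = -(p.s • ((Am p * Ki p * P p) ⊗ₜ cgen p .a))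
    + p.s⁻¹ • ((Ap p * Ki p * P p) ⊗ₜ cgen p .m)
    + ((p.s - p.s⁻¹) / (p.q - p.q⁻¹)) • ((Ki p ^ 2 * P p) ⊗ₜ cgen p .k)
    + Gam p ⊗ₜ cgen p .k + (Ki p ^ 2 * P p) ⊗ₜ cgen p .g := by
  apply emb_injective p
  rw [emb_comulI]
  simp only [cgen, cval, comul_Gam, map_add, map_neg, map_smul, emb_tmul]

lemma lTensor_defect_comulI_Gam :
    (defectLin p).lTensor (Osp p) (comulI p (cgen p .g))
      = (p.s + p.s⁻¹) • (Gam p ⊗ₜ (1 ⊗ₜ cgen p .g)) := by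
  have h (i : CGen) : defectLin p (cgen p i) = defect p (cgen p i) := rfl
  simp only [comulI_Gam, map_add, map_neg, map_smul, LinearMap.lTensor_tmul, h, defect_cgen, defectCoeff,
    zero_smul, TensorProduct.tmul_zero, TensorProduct.tmul_smul]
  -- The terms in A₊K and A₋K vanish, and those with first leg K⁻²P cancel between K²P and Γ. The
  -- defect coefficient of Γ is just -1, since s² = q; in its unsimplified form the cancellation
  -- needs no division.
  module

/-- The factors embedded by `inR` have a 1 in the first position, so multiplying by them leaves the
first leg of z untouched and the definition of the defect can be read off in the other two. -/
lemma lTensor_defect (z : Osp p ⊗[ℂ] coideal p) :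
    (defectLin p).lTensor (Osp p) z =
      p.s • (map (AlgHom.id ℂ (Osp p)) (inclLeft p (coideal p)) z
        * inR p (Osp p ⊗[ℂ] coideal p) (comulI p (cgen p .g)))
      + p.s⁻¹ • (inR p (Osp p ⊗[ℂ] coideal p) (comulI p (cgen p .g))
        * map (AlgHom.id ℂ (Osp p)) (inclLeft p (coideal p)) z)
      - map (AlgHom.id ℂ (Osp p)) (tau p) z
      - (p.s + p.s⁻¹) • (inR p (Osp p ⊗[ℂ] coideal p) (inL p (coideal p) (Gam p)) * map (AlgHom.id ℂ (Osp p)) (comulI p) z) := by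
  induction z using TensorProduct.induction_on with
  | zero => simp only [map_zero, zero_mul, mul_zero, smul_zero, add_zero, sub_zero]
  | tmul x b =>
    have h : defectLin p b = defect p b := rfl
    simp only [LinearMap.lTensor_tmul, h, defect, Algebra.TensorProduct.map_tmul, AlgHom.id_apply,
      Algebra.TensorProduct.tmul_mul_tmul, one_mul, mul_one, inclLeft_apply,
      Algebra.TensorProduct.includeLeft_apply, Algebra.TensorProduct.includeRight_apply,
      TensorProduct.tmul_add, TensorProduct.tmul_sub, TensorProduct.tmul_smul]
  | add z w hz hw =>
    simp only [map_add, hz, hw, add_mul, mul_add]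
    module

/-- The rank three relation `{Γ₁₂, Γ₂₃} = Γ₁₃ + (s + s⁻¹) (Γ₂ Γ₁₂₃ + Γ₁ Γ₃)`, solved for `Γ₁₃`. -/
lemma rank_three_relation :
    map (AlgHom.id ℂ (Osp p)) (tau p) (comulI p (cgen p .g)) =
      p.s • (map (AlgHom.id ℂ (Osp p)) (inclLeft p (coideal p)) (comulI p (cgen p .g))
        * inR p (Osp p ⊗[ℂ] coideal p) (comulI p (cgen p .g)))
      + p.s⁻¹ • (inR p (Osp p ⊗[ℂ] coideal p) (comulI p (cgen p .g))
        * map (AlgHom.id ℂ (Osp p)) (inclLeft p (coideal p)) (comulI p (cgen p .g)))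
      - (p.s + p.s⁻¹) • (inR p (Osp p ⊗[ℂ] coideal p) (inL p (coideal p) (Gam p))
          * map (AlgHom.id ℂ (Osp p)) (comulI p) (comulI p (cgen p .g))
        + inL p (Osp p ⊗[ℂ] coideal p) (Gam p)
          * inR p (Osp p ⊗[ℂ] coideal p) (inR p (coideal p) (cgen p .g))) := by
  -- For z = Δ(Γ) the right side contains, in order, Γ₁₂Γ₂₃, Γ₂₃Γ₁₂, Γ₁₃ and Γ₂Γ₁₂₃; the left side
  -- is (s + s⁻¹) Γ₁Γ₃.
  have h1 := lTensor_defect p (comulI p (cgen p .g))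
  rw [lTensor_defect_comulI_Gam] at h1
  have h2 : inL p (Osp p ⊗[ℂ] coideal p) (Gam p)
      * inR p (Osp p ⊗[ℂ] coideal p) (inR p (coideal p) (cgen p .g))
      = Gam p ⊗ₜ (1 ⊗ₜ cgen p .g) := by
    simp only [inL, inR, Algebra.TensorProduct.includeLeft_apply,
      Algebra.TensorProduct.includeRight_apply, Algebra.TensorProduct.tmul_mul_tmul, one_mul,
      mul_one]
  rw [h2, smul_add, h1]
  abel

end RankThree

/-! ### Coassociativity on U and on I -/

section Coassoc

open FreeAlgebra Algebra.TensorProduct in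
lemma comul_coassoc (x : Osp p) :
    map (AlgHom.id ℂ (Osp p)) (comul p) (comul p x)
      = Algebra.TensorProduct.assoc ℂ ℂ ℂ (Osp p) (Osp p) (Osp p)
          (map (comul p) (AlgHom.id ℂ (Osp p)) (comul p x)) := by
  have h : ((map (AlgHom.id ℂ (Osp p)) (comul p)).comp (comul p)).comp (mkOsp p)
      = (((Algebra.TensorProduct.assoc ℂ ℂ ℂ (Osp p) (Osp p) (Osp p) :
          (Osp p ⊗[ℂ] Osp p) ⊗[ℂ] Osp p →ₐ[ℂ] _).comp
          (map (comul p) (AlgHom.id ℂ (Osp p)))).comp (comul p)).comp (mkOsp p) := by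
    ext i
    cases i
    · change map _ _ (comul p (Ap p)) = Algebra.TensorProduct.assoc ℂ ℂ ℂ _ _ _
        (map _ _ (comul p (Ap p)))
      simp [comul_Ap, comul_K, comul_Ki, comul_P, TensorProduct.add_tmul, TensorProduct.tmul_add,
        add_assoc]
    · change map _ _ (comul p (Am p)) = Algebra.TensorProduct.assoc ℂ ℂ ℂ _ _ _
        (map _ _ (comul p (Am p)))
      simp [comul_Am, comul_K, comul_Ki, comul_P, TensorProduct.add_tmul, TensorProduct.tmul_add,
        add_assoc]
    · change map _ _ (comul p (K p)) = Algebra.TensorProduct.assoc ℂ ℂ ℂ _ _ _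
        (map _ _ (comul p (K p)))
      simp [comul_K]
    · change map _ _ (comul p (Ki p)) = Algebra.TensorProduct.assoc ℂ ℂ ℂ _ _ _
        (map _ _ (comul p (Ki p)))
      simp [comul_Ki]
    · change map _ _ (comul p (P p)) = Algebra.TensorProduct.assoc ℂ ℂ ℂ _ _ _
        (map _ _ (comul p (P p)))
      simp [comul_P]
  obtain ⟨w, rfl⟩ := RingQuot.mkAlgHom_surjective ℂ (Rel p) x
  exact DFunLike.congr_fun h w

/-- `x ⊗ y ↦ Δ(x) ⊗ y`, with the parentheses moved to the right. -/
def comulLeft (B : Type) [Ring B] [Algebra ℂ B] : Osp p ⊗[ℂ] B →ₐ[ℂ] Osp p ⊗[ℂ] (Osp p ⊗[ℂ] B) :=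
  (Algebra.TensorProduct.assoc ℂ ℂ ℂ (Osp p) (Osp p) B :
    (Osp p ⊗[ℂ] Osp p) ⊗[ℂ] B →ₐ[ℂ] Osp p ⊗[ℂ] (Osp p ⊗[ℂ] B)).comp
    (Algebra.TensorProduct.map (comul p) (AlgHom.id ℂ B))

lemma comulLeft_tmul (B : Type) [Ring B] [Algebra ℂ B] (x : Osp p) (y : B) :
    comulLeft p B (x ⊗ₜ y) = Algebra.TensorProduct.assoc ℂ ℂ ℂ (Osp p) (Osp p) B (comul p x ⊗ₜ y) :=
  rfl

/-- The maps Δ and f act on different tensor factors, hence commute. -/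
lemma comulLeft_comp_map {B C : Type} [Ring B] [Algebra ℂ B] [Ring C] [Algebra ℂ C]
    (f : B →ₐ[ℂ] C) :
    (comulLeft p C).comp (Algebra.TensorProduct.map (AlgHom.id ℂ (Osp p)) f)
      = (Algebra.TensorProduct.map (AlgHom.id ℂ (Osp p))
          (Algebra.TensorProduct.map (AlgHom.id ℂ (Osp p)) f)).comp (comulLeft p B) := by
  apply Algebra.TensorProduct.ext'
  intro x y
  simp only [AlgHom.comp_apply, Algebra.TensorProduct.map_tmul, comulLeft_tmul, AlgHom.id_apply]
  induction comul p x using TensorProduct.induction_on with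
  | zero => simp
  | tmul a b => simp
  | add a b ha hb => simp only [TensorProduct.add_tmul, map_add, ha, hb]

/-- Inherited from U: tensoring the injection of U ⊗ I in U ⊗ U with U keeps it injective by
flatness, so the identity can be tested in U ⊗ U ⊗ U. -/
lemma comulI_coassoc :
    (Algebra.TensorProduct.map (AlgHom.id ℂ (Osp p)) (comulI p)).comp (comulI p)
      = (comulLeft p (coideal p)).comp (comulI p) := by
  have hinj : Function.Injective (Algebra.TensorProduct.map (AlgHom.id ℂ (Osp p)) (emb p)) :=
    Module.Flat.lTensor_preserves_injective_linearMap (M := Osp p) (emb p).toLinearMap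
      (emb_injective p)
  have h1 : (emb p).comp (comulI p) = (comul p).comp (coideal p).val :=
    AlgHom.ext (emb_comulI p)
  refine AlgHom.ext fun x => hinj ?_
  have h2 : ∀ z, Algebra.TensorProduct.map (AlgHom.id ℂ (Osp p)) (emb p)
      (Algebra.TensorProduct.map (AlgHom.id ℂ (Osp p)) (comulI p) z)
      = Algebra.TensorProduct.map (AlgHom.id ℂ (Osp p)) (comul p) (emb p z) := by
    intro z
    rw [emb, ← AlgHom.comp_apply, ← AlgHom.comp_apply, ← Algebra.TensorProduct.map_comp,
      ← Algebra.TensorProduct.map_comp, ← emb, h1]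
  have h3 := DFunLike.congr_fun (comulLeft_comp_map p (coideal p).val) (comulI p x)
  simp only [AlgHom.comp_apply] at h3 ⊢
  rw [h2, emb_comulI, comul_coassoc, ← emb_comulI]
  exact h3

end Coassoc

/-! ### One step of the extension process -/

section Extension

/-- `f ↦ 1 ⊗ f`. -/
abbrev idTensor {B C : Type} [Ring B] [Algebra ℂ B] [Ring C] [Algebra ℂ C] (f : B →ₐ[ℂ] C) :
    Osp p ⊗[ℂ] B →ₐ[ℂ] Osp p ⊗[ℂ] C :=
  Algebra.TensorProduct.map (AlgHom.id ℂ (Osp p)) f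

lemma idTensor_comp {B C D : Type} [Ring B] [Algebra ℂ B] [Ring C] [Algebra ℂ C] [Ring D]
    [Algebra ℂ D] (g : C →ₐ[ℂ] D) (f : B →ₐ[ℂ] C) :
    idTensor p (g.comp f) = (idTensor p g).comp (idTensor p f) := by
  simp only [idTensor, ← Algebra.TensorProduct.map_comp, AlgHom.comp_id]

lemma idTensor_id (B : Type) [Ring B] [Algebra ℂ B] :
    idTensor p (AlgHom.id ℂ B) = AlgHom.id ℂ _ :=
  Algebra.TensorProduct.map_id

/-- The identification of `I` with `Tail p true`. -/
def tailIn : (b : Bool) → b = true → (coideal p →ₐ[ℂ] Tail p b)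
  | true, _ => AlgHom.id ℂ (coideal p)

/-- The identification of `osp_q(1|2) ⊗ I` with `Tail p false`. -/
def tailOut : (b : Bool) → b = false → (Osp p ⊗[ℂ] coideal p →ₐ[ℂ] Tail p b)
  | false, _ => AlgHom.id ℂ (Osp p ⊗[ℂ] coideal p)

lemma startGam_eq (b : Bool) (hb : b = true) : startGam p b hb = tailIn p b hb (cgen p .g) := by
  subst hb; rfl

lemma close_comp_tailIn (r : ℕ) (b : Bool) (hb : b = true) :
    (close p r b hb).comp (tailIn p b hb) = (cons p r).comp (inclLeft p (Pow p r)) := by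
  subst hb; rfl

/-- The Booleans are variables with equations because they will be `decide (k ∈ A)`, on which the
type `Tail` depends. Composing with `tailIn` and `tailOut` gives source types free of A, so that
different index sets can be compared. -/
lemma extStep_in_in (b b' : Bool) (hb : b = true) (hb' : b' = true) :
    (extStep p b b').comp (tailIn p b hb) = (idTensor p (tailIn p b' hb')).comp (comulI p) := by
  subst hb hb'
  exact (congrArg (AlgHom.comp · (comulI p)) (idTensor_id p (coideal p))).symm

lemma extStep_in_out (b b' : Bool) (hb : b = true) (hb' : b' = false) :
    (extStep p b b').comp (tailIn p b hb)
      = (idTensor p (tailOut p b' hb')).comp ((idTensor p (tau p)).comp (comulI p)) := by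
  subst hb hb'
  exact (congrArg (AlgHom.comp · ((idTensor p (tau p)).comp (comulI p)))
    (idTensor_id p (Osp p ⊗[ℂ] coideal p))).symm

lemma extStep_out_out (b b' : Bool) (hb : b = false) (hb' : b' = false) :
    (extStep p b b').comp (tailOut p b hb)
      = (idTensor p (tailOut p b' hb')).comp (comulLeft p (coideal p)) := by
  subst hb hb'
  exact (congrArg (AlgHom.comp · (comulLeft p (coideal p)))
    (idTensor_id p (Osp p ⊗[ℂ] coideal p))).symm

lemma extStep_out_in (b b' : Bool) (hb : b = false) (hb' : b' = true) :
    (extStep p b b').comp (tailOut p b hb) = idTensor p (tailIn p b' hb') := by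
  subst hb hb'
  exact (idTensor_id p (coideal p)).symm

/-- The extension morphisms starting from an index `k ∈ A`. -/
def extIn (A : Finset ℕ) (r k : ℕ) (hk : k ∈ A) : coideal p →ₐ[ℂ] Pow p (r + 1) :=
  (ext p A r k ⟨k, hk, le_rfl, Nat.le_add_right k r⟩).comp
    (tailIn p _ (decide_eq_true hk))

/-- The extension morphisms starting from an index `k ∉ A`. -/
def extOut (A : Finset ℕ) (r k : ℕ) (hk : k ∉ A) (h : ∃ j ∈ A, k ≤ j ∧ j ≤ k + r) :
    Osp p ⊗[ℂ] coideal p →ₐ[ℂ] Pow p (r + 1) :=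
  (ext p A r k h).comp (tailOut p _ (decide_eq_false hk))

variable {A : Finset ℕ} {r k : ℕ}

lemma extIn_last (hk : k ∈ A) (h : ∀ j ∈ A, k < j → k + r < j) :
    extIn p A r k hk = (cons p r).comp (inclLeft p (Pow p r)) := by
  cases r with
  | zero => exact close_comp_tailIn p 0 _ _
  | succ r =>
    have h' : ¬ ∃ j ∈ A, k + 1 ≤ j ∧ j ≤ k + 1 + r := by
      rintro ⟨j, hj, h1, h2⟩
      have := h j hj h1
      omega
    rw [extIn, ext, dif_neg h']
    exact close_comp_tailIn p (r + 1) _ _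

lemma ext_succ (h : ∃ j ∈ A, k ≤ j ∧ j ≤ k + (r + 1)) (h' : ∃ j ∈ A, k + 1 ≤ j ∧ j ≤ k + 1 + r) :
    ext p A (r + 1) k h = (cons p (r + 1)).comp ((idTensor p (ext p A r (k + 1) h')).comp
      (extStep p (decide (k ∈ A)) (decide (k + 1 ∈ A)))) := by
  rw [ext, dif_pos h']

lemma extIn_succ_in (hk : k ∈ A) (hk' : k + 1 ∈ A) :
    extIn p A (r + 1) k hk
      = (cons p (r + 1)).comp ((idTensor p (extIn p A r (k + 1) hk')).comp (comulI p)) := by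
  rw [extIn, ext_succ p _ ⟨k + 1, hk', le_rfl, Nat.le_add_right _ _⟩, AlgHom.comp_assoc,
    AlgHom.comp_assoc, extStep_in_in p _ _ _ (decide_eq_true hk'), extIn, idTensor_comp]
  rfl

lemma extIn_succ_out (hk : k ∈ A) (hk' : k + 1 ∉ A) (h : ∃ j ∈ A, k + 1 ≤ j ∧ j ≤ k + 1 + r) :
    extIn p A (r + 1) k hk
      = (cons p (r + 1)).comp ((idTensor p ((extOut p A r (k + 1) hk' h).comp (tau p))).comp
          (comulI p)) := by
  rw [extIn, ext_succ p _ h, AlgHom.comp_assoc, AlgHom.comp_assoc,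
    extStep_in_out p _ _ _ (decide_eq_false hk'), extOut, idTensor_comp, idTensor_comp]
  rfl

lemma extOut_succ_out (hk : k ∉ A) (h0 : ∃ j ∈ A, k ≤ j ∧ j ≤ k + (r + 1)) (hk' : k + 1 ∉ A)
    (h : ∃ j ∈ A, k + 1 ≤ j ∧ j ≤ k + 1 + r) :
    extOut p A (r + 1) k hk h0
      = (cons p (r + 1)).comp ((idTensor p (extOut p A r (k + 1) hk' h)).comp
          (comulLeft p (coideal p))) := by
  rw [extOut, ext_succ p _ h, AlgHom.comp_assoc, AlgHom.comp_assoc,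
    extStep_out_out p _ _ _ (decide_eq_false hk'), extOut, idTensor_comp]
  rfl

lemma extOut_succ_in (hk : k ∉ A) (h0 : ∃ j ∈ A, k ≤ j ∧ j ≤ k + (r + 1)) (hk' : k + 1 ∈ A) :
    extOut p A (r + 1) k hk h0
      = (cons p (r + 1)).comp (idTensor p (extIn p A r (k + 1) hk')) := by
  rw [extOut, ext_succ p _ ⟨k + 1, hk', le_rfl, Nat.le_add_right _ _⟩, AlgHom.comp_assoc,
    AlgHom.comp_assoc, extStep_out_in p _ _ _ (decide_eq_true hk'), extIn, idTensor_comp]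

end Extension

/-! ### Dependence on A only inside the window -/

section Congr

/-- The process started at k only inspects membership of k, …, k + r. This is needed because the
sets in the relation agree with A only past the first hole. Both cases are proved together since a
step may enter or leave A. -/
lemma ext_congr {A B : Finset ℕ} (r : ℕ) : ∀ k : ℕ,
    (∀ j, k ≤ j → j ≤ k + r → (j ∈ A ↔ j ∈ B)) →
    (∀ hA hB, extIn p A r k hA = extIn p B r k hB) ∧
    (∀ hA hA' hB hB', extOut p A r k hA hA' = extOut p B r k hB hB') := by
  induction r with
  | zero =>
    intro k h
    refine ⟨fun hA hB => ?_, fun hA hA' => ?_⟩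
    · rw [extIn_last p hA fun j _ hj => hj, extIn_last p hB fun j _ hj => hj]
    · obtain ⟨j, hj, h1, h2⟩ := hA'
      exact absurd ((show j = k by omega) ▸ hj) hA
  | succ r ih =>
    intro k h
    obtain ⟨ih1, ih2⟩ := ih (k + 1) fun j h1 h2 => h j (by omega) (by omega)
    have hk := h (k + 1) (by omega) (by omega)
    have hex : (∃ j ∈ A, k + 1 ≤ j ∧ j ≤ k + 1 + r) ↔ (∃ j ∈ B, k + 1 ≤ j ∧ j ≤ k + 1 + r) := by
      constructor
      · rintro ⟨j, hj, h1, h2⟩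
        exact ⟨j, (h j (by omega) (by omega)).1 hj, h1, h2⟩
      · rintro ⟨j, hj, h1, h2⟩
        exact ⟨j, (h j (by omega) (by omega)).2 hj, h1, h2⟩
    refine ⟨fun hA hB => ?_, fun hA hA' hB hB' => ?_⟩
    · by_cases h1 : k + 1 ∈ A
      · rw [extIn_succ_in p hA h1, extIn_succ_in p hB (hk.1 h1), ih1 h1 (hk.1 h1)]
      · have h1' := fun h' => h1 (hk.2 h')
        by_cases h2 : ∃ j ∈ A, k + 1 ≤ j ∧ j ≤ k + 1 + r
        · rw [extIn_succ_out p hA h1 h2, extIn_succ_out p hB h1' (hex.1 h2),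
            ih2 h1 h2 h1' (hex.1 h2)]
        · have h2' := fun h' => h2 (hex.2 h')
          rw [extIn_last p hA fun j hj h3 => by by_contra h4; exact h2 ⟨j, hj, h3, by omega⟩,
            extIn_last p hB fun j hj h3 => by by_contra h4; exact h2' ⟨j, hj, h3, by omega⟩]
    · by_cases h1 : k + 1 ∈ A
      · rw [extOut_succ_in p hA hA' h1, extOut_succ_in p hB hB' (hk.1 h1), ih1 h1 (hk.1 h1)]
      · have h1' := fun h' => h1 (hk.2 h')
        have h2 : ∃ j ∈ A, k + 1 ≤ j ∧ j ≤ k + 1 + r := by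
          obtain ⟨j, hj, h3, h4⟩ := hA'
          have : j ≠ k := fun h' => hA (h' ▸ hj)
          exact ⟨j, hj, by omega, by omega⟩
        rw [extOut_succ_out p hA hA' h1 h2, extOut_succ_out p hB hB' h1' (hex.1 h2),
          ih2 h1 h2 h1' (hex.1 h2)]

end Congr

/-! ### Blocks and holes as iterated coproducts -/

section Spread

/-- `x ⊗ y ↦ Δ^(a)(x) ⊗ y`, where `Δ^(a)` is the `a`-fold iterated coproduct. -/
def spread (m : ℕ) : (a : ℕ) → Osp p ⊗[ℂ] Pow p m →ₐ[ℂ] Pow p (m + a + 1)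
  | 0 => cons p m
  | a + 1 => (cons p (m + a + 1)).comp ((idTensor p (spread m a)).comp (comulLeft p (Pow p m)))

lemma comulLeft_comp_inclLeft (B : Type) [Ring B] [Algebra ℂ B] :
    (comulLeft p B).comp (inclLeft p B) = (idTensor p (inclLeft p B)).comp (comulI p) := by
  refine AlgHom.ext fun x => ?_
  simp only [AlgHom.comp_apply, inclLeft_apply, comulLeft_tmul]
  rw [← emb_comulI]
  induction comulI p x using TensorProduct.induction_on with
  | zero => simp
  | tmul a b => simp [emb_tmul, inclLeft_apply]
  | add a b ha hb => simp only [TensorProduct.add_tmul, map_add, ha, hb]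

lemma comulLeft_inR (B : Type) [Ring B] [Algebra ℂ B] (y : B) :
    comulLeft p B (inR p B y) = inR p (Osp p ⊗[ℂ] B) (inR p B y) := by
  simp [comulLeft_tmul, Algebra.TensorProduct.one_def]

lemma cons_inR (m : ℕ) (y : Pow p m) : cons p m (inR p _ y) = shift p m y := by
  rw [inR, Algebra.TensorProduct.includeRight_apply, cons, Algebra.TensorProduct.lift_tmul,
    map_one, one_mul]

lemma spread_inR_succ (m a : ℕ) (y : Pow p m) :
    spread p m (a + 1) (inR p _ y) = shift p (m + a + 1) (spread p m a (inR p _ y)) := by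
  rw [spread, AlgHom.comp_apply, AlgHom.comp_apply, comulLeft_inR, ← cons_inR]
  rfl

lemma spread_inR_zero (m : ℕ) (y : Pow p m) : spread p m 0 (inR p _ y) = shift p m y := by
  rw [spread, cons_inR]

variable {A : Finset ℕ}

/-- Along a block the process applies Δ repeatedly to the last factor; by coassociativity one Δ
suffices there, the others acting on the first leg. What follows the block enters only through ψ, so
the same statement serves whether the next position is a hole or not. -/
lemma extIn_block {m : ℕ} {ψ : coideal p →ₐ[ℂ] Pow p m} (a : ℕ) {k e : ℕ} (he : e = k + a) (hk : k ∈ A)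
    (heA : e ∈ A) (hA : ∀ j, k ≤ j → j ≤ e → j ∈ A)
    (h : extIn p A m e heA
      = (cons p m).comp ((idTensor p ψ).comp (comulI p))) :
    extIn p A (m + a) k hk
      = (spread p m a).comp ((idTensor p ψ).comp (comulI p)) := by
  induction a generalizing k with
  | zero => subst he; exact h
  | succ a ih =>
    have ih' := ih (k := k + 1) (by omega) (hA _ (by omega) (by omega))
      (fun j h1 h2 => hA j (by omega) h2)
    refine (extIn_succ_in p (r := m + a) hk (hA (k + 1) (by omega) (by omega))).trans ?_
    rw [ih', idTensor_comp, idTensor_comp, AlgHom.comp_assoc, AlgHom.comp_assoc, comulI_coassoc,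
      spread, AlgHom.comp_assoc, AlgHom.comp_assoc, ← AlgHom.comp_assoc (comulLeft p _),
      comulLeft_comp_map]
    rfl

lemma extIn_last_block {m : ℕ} (a : ℕ) {k e : ℕ} (he : e = k + a) (hk : k ∈ A)
    (hA : ∀ j, k ≤ j → j ≤ e → j ∈ A) (h : ∀ j ∈ A, e < j → e + m < j) :
    extIn p A (m + a) k hk
      = (spread p m a).comp (inclLeft p (Pow p m)) := by
  induction a generalizing k with
  | zero => subst he; exact extIn_last p _ h
  | succ a ih =>
    have ih' := ih (k := k + 1) (by omega) (hA _ (by omega) (by omega))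
      (fun j h1 h2 => hA j (by omega) h2)
    refine (extIn_succ_in p (r := m + a) hk (hA (k + 1) (by omega) (by omega))).trans ?_
    rw [ih', idTensor_comp, AlgHom.comp_assoc, ← comulLeft_comp_inclLeft,
      spread, AlgHom.comp_assoc, AlgHom.comp_assoc]

/-- Within a hole Δ acts on the hole factor alone, while the element of I waits until e is reached.
Thus the factor created by τ is spread over the h + 1 points of the hole. -/
lemma extOut_hole {r : ℕ} (h : ℕ) {k e : ℕ} (he : e = k + h + 1) (hk : k ∉ A)
    (hA : ∀ j, k ≤ j → j < e → j ∉ A) (heA : e ∈ A) :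
    extOut p A (r + 1 + h) k hk ⟨e, heA, by omega, by omega⟩
      = (spread p (r + 1) h).comp (idTensor p (extIn p A r e heA)) := by
  induction h generalizing k with
  | zero => subst he; exact extOut_succ_in p _ _ heA
  | succ h ih =>
    have ih' := ih (k := k + 1) (by omega) (hA _ (by omega) (by omega))
      (fun j h1 h2 => hA j (by omega) h2)
    refine (extOut_succ_out p (r := r + 1 + h) hk ⟨e, heA, by omega, by omega⟩ (hA (k + 1) (by omega) (by omega))
      ⟨e, heA, by omega, by omega⟩).trans ?_
    rw [ih', idTensor_comp, AlgHom.comp_assoc, ← comulLeft_comp_map,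
      spread, AlgHom.comp_assoc, AlgHom.comp_assoc]

lemma gammaFrom_of_mem {r k : ℕ} (hk : k ∈ A) :
    gammaFrom p A (r + 1) k = extIn p A r k hk (cgen p .g) := by
  rw [gammaFrom, dif_pos hk, startGam_eq]
  rfl

lemma gammaFrom_of_notMem {r k : ℕ} (hk : k ∉ A) :
    gammaFrom p A (r + 1) k = shift p r (gammaFrom p A r (k + 1)) := by
  rw [gammaFrom, dif_neg hk]

/-- Iterated coproducts fix the unit, so the leading units may be read as a single factor 1 spread
over a + 1 positions. -/
lemma gammaFrom_spread {m : ℕ} (a : ℕ) {k e : ℕ} (he : e = k + a + 1)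
    (hA : ∀ j, k ≤ j → j < e → j ∉ A) :
    gammaFrom p A (m + a + 1) k = spread p m a (inR p _ (gammaFrom p A m e)) := by
  induction a generalizing k with
  | zero =>
    subst he
    rw [spread_inR_zero]
    exact gammaFrom_of_notMem p (hA k le_rfl (by omega))
  | succ a ih =>
    rw [spread_inR_succ, ← ih (k := k + 1) (by omega) (fun j h1 h2 => hA j (by omega) h2)]
    exact gammaFrom_of_notMem p (hA k le_rfl (by omega))

end Spread

/-! ### The rank three relation for a general index set -/

section Relation

variable {A : Finset ℕ}

lemma gammaFrom_block {m : ℕ} {ψ : coideal p →ₐ[ℂ] Pow p m} (a : ℕ) {k e : ℕ} (he : e = k + a)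
    (heA : e ∈ A) (hA : ∀ j, k ≤ j → j ≤ e → j ∈ A)
    (h : extIn p A m e heA = (cons p m).comp ((idTensor p ψ).comp (comulI p))) :
    gammaFrom p A (m + a + 1) k = spread p m a (idTensor p ψ (comulI p (cgen p .g))) := by
  have hk := hA k le_rfl (by omega)
  rw [gammaFrom_of_mem p hk, extIn_block p a he hk heA hA h]
  rfl

/-- The right side no longer mentions A; this identifies Γ_A with the Γ of an interval when the
first block is the only one in the window. -/
lemma gammaFrom_last_block {m : ℕ} (a : ℕ) {k e : ℕ} (he : e = k + a)
    (hA : ∀ j, k ≤ j → j ≤ e → j ∈ A) (h : ∀ j ∈ A, e < j → e + m < j) :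
    gammaFrom p A (m + a + 1) k = spread p m a (inL p _ (Gam p)) := by
  have hk := hA k le_rfl (by omega)
  rw [gammaFrom_of_mem p hk, extIn_last_block p a he hk hA h]
  rfl

/-- Expresses `Γ_A`, for a set `A` with first block `{k, …, k + a}` and first hole
`{k + a + 1, …, k + a + 1 + h}`, by sets with fewer missing points. -/
lemma gammaFrom_relation (a h r k : ℕ) (hblock : ∀ j, k ≤ j → j ≤ k + a → j ∈ A)
    (hhole : ∀ j, k + a + 1 ≤ j → j ≤ k + a + 1 + h → j ∉ A) (hnext : k + a + 1 + h + 1 ∈ A)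
    (N : ℕ) (hN : N = r + 1 + h + 1 + a + 1) :
    gammaFrom p A N k =
      p.s • (gammaFrom p (Finset.Icc k (k + a + 1 + h)) N k
        * gammaFrom p (A \ Finset.Icc k (k + a) ∪ Finset.Icc (k + a + 1) (k + a + 1 + h)) N k)
      + p.s⁻¹ • (gammaFrom p (A \ Finset.Icc k (k + a)
            ∪ Finset.Icc (k + a + 1) (k + a + 1 + h)) N k
        * gammaFrom p (Finset.Icc k (k + a + 1 + h)) N k)
      - (p.s + p.s⁻¹) • (gammaFrom p (Finset.Icc (k + a + 1) (k + a + 1 + h)) N k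
          * gammaFrom p (A ∪ Finset.Icc (k + a + 1) (k + a + 1 + h)) N k
        + gammaFrom p (Finset.Icc k (k + a)) N k
          * gammaFrom p (A \ Finset.Icc k (k + a)) N k) := by
  subst hN
  -- E handles the rest of A from its first point after the hole; F adds the h + 1 positions of the
  -- hole, and G the a + 1 positions of the block.
  set E : coideal p →ₐ[ℂ] Pow p (r + 1) := extIn p A r _ hnext with hE
  set F : Osp p ⊗[ℂ] coideal p →ₐ[ℂ] Pow p (r + 1 + h + 1) :=
    (spread p (r + 1) h).comp (idTensor p E) with hF
  set G : Osp p ⊗[ℂ] (Osp p ⊗[ℂ] coideal p) →ₐ[ℂ] Pow p (r + 1 + h + 1 + a + 1) :=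
    (spread p (r + 1 + h + 1) a).comp (idTensor p F) with hG
  have hcomp {B : Type} [Ring B] [Algebra ℂ B] (f : B →ₐ[ℂ] Osp p ⊗[ℂ] coideal p)
      (z : Osp p ⊗[ℂ] B) : spread p (r + 1 + h + 1) a (idTensor p (F.comp f) z)
        = G (idTensor p f z) := by
    rw [idTensor_comp]; rfl
  have hFL (x : Osp p) : F (inL p _ x) = spread p (r + 1) h (inL p _ x) := by
    simp [hF]
  have hFR (x : coideal p) : F (inR p _ x) = spread p (r + 1) h (inR p _ (E x)) := by
    simp [hF]
  have hGL (x : Osp p) : G (inL p _ x) = spread p (r + 1 + h + 1) a (inL p _ x) := by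
    simp [hG]
  have hGR (x : Osp p ⊗[ℂ] coideal p) :
      G (inR p _ x) = spread p (r + 1 + h + 1) a (inR p _ (F x)) := by
    simp [hG]
  -- If S contains the hole and continues like A, hole and rest are joined by a coproduct: filling
  -- the hole replaces τ by Δ. This covers both Γ₁₂₃ and Γ₂₃.
  have hfill {S : Finset ℕ} (hb : k + a + 1 ∈ S)
      (hS : ∀ j, k + a + 1 ≤ j → j ≤ k + a + 1 + h + 1 → j ∈ S)
      (hS' : ∀ j, k + a + 1 + h + 1 ≤ j → j ≤ k + a + 1 + h + 1 + r → (j ∈ S ↔ j ∈ A)) :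
      extIn p S (r + 1 + h) (k + a + 1) hb = F.comp (comulI p) := by
    rw [extIn_block p (ψ := E) h rfl hb (hS _ (by omega) (by omega))
      (fun j h1 h2 => hS j h1 (by omega))]
    · rfl
    · rw [extIn_succ_in p (r := r) _ (hS _ (by omega) le_rfl), (ext_congr p r _ hS').1 _ hnext]
  have g13 : gammaFrom p A (r + 1 + h + 1 + a + 1) k
      = G (idTensor p (tau p) (comulI p (cgen p .g))) := by
    rw [gammaFrom_block p (ψ := F.comp (tau p)) a rfl (hblock _ (by omega) le_rfl) hblock, hcomp]
    rw [extIn_succ_out p (r := r + 1 + h) _ (hhole _ le_rfl (by omega))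
      ⟨_, hnext, by omega, by omega⟩, extOut_hole p h rfl _
      (fun j h1 h2 => hhole j h1 (by omega)) hnext]
  have g123 : gammaFrom p (A ∪ Finset.Icc (k + a + 1) (k + a + 1 + h)) (r + 1 + h + 1 + a + 1) k
      = G (idTensor p (comulI p) (comulI p (cgen p .g))) := by
    have hS : ∀ j, k + a + 1 ≤ j → j ≤ k + a + 1 + h + 1 →
        j ∈ A ∪ Finset.Icc (k + a + 1) (k + a + 1 + h) := by
      intro j h1 h2
      rw [Finset.mem_union, Finset.mem_Icc]
      by_cases h3 : j = k + a + 1 + h + 1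
      · exact Or.inl (h3 ▸ hnext)
      · exact Or.inr (by omega)
    rw [gammaFrom_block p (ψ := F.comp (comulI p)) a rfl
      (Finset.mem_union_left _ (hblock _ (by omega) le_rfl))
      (fun j h1 h2 => Finset.mem_union_left _ (hblock j h1 h2)), hcomp]
    rw [extIn_succ_in p (r := r + 1 + h) _ (hS _ le_rfl (by omega)), hfill _ hS]
    intro j h1 h2
    simp only [Finset.mem_union, Finset.mem_Icc]
    exact or_iff_left (by omega)
  have g12 : gammaFrom p (Finset.Icc k (k + a + 1 + h)) (r + 1 + h + 1 + a + 1) k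
      = G (idTensor p (inclLeft p (coideal p)) (comulI p (cgen p .g))) := by
    have hF' : F.comp (inclLeft p (coideal p))
        = (spread p (r + 1) h).comp (inclLeft p (Pow p (r + 1))) := AlgHom.ext fun x => hFL x
    have hS : ∀ j, k ≤ j → j ≤ k + a + 1 + h → j ∈ Finset.Icc k (k + a + 1 + h) :=
      fun j h1 h2 => Finset.mem_Icc.2 ⟨h1, h2⟩
    rw [gammaFrom_block p (ψ := F.comp (inclLeft p (coideal p))) a rfl
      (hS _ (by omega) (by omega)) (fun j h1 h2 => hS j h1 (by omega)), hcomp]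
    rw [extIn_succ_in p (r := r + 1 + h) _ (hS (k + a + 1) (by omega) (by omega)),
      extIn_last_block p h rfl _ (fun j h1 h2 => hS j (by omega) h2), hF']
    intro j h1 h2
    rw [Finset.mem_Icc] at h1
    omega
  have g23 : gammaFrom p (A \ Finset.Icc k (k + a) ∪ Finset.Icc (k + a + 1) (k + a + 1 + h))
      (r + 1 + h + 1 + a + 1) k = G (inR p _ (comulI p (cgen p .g))) := by
    have hS : ∀ j, k + a + 1 ≤ j → j ≤ k + a + 1 + h + 1 →
        j ∈ A \ Finset.Icc k (k + a) ∪ Finset.Icc (k + a + 1) (k + a + 1 + h) := by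
      intro j h1 h2
      simp only [Finset.mem_union, Finset.mem_sdiff, Finset.mem_Icc]
      by_cases h3 : j = k + a + 1 + h + 1
      · exact Or.inl ⟨h3 ▸ hnext, by omega⟩
      · exact Or.inr (by omega)
    rw [gammaFrom_spread p a (e := k + a + 1) rfl, hGR, gammaFrom_of_mem p (hS _ le_rfl (by omega)),
      hfill _ hS]
    · rfl
    · intro j h1 h2
      simp only [Finset.mem_union, Finset.mem_sdiff, Finset.mem_Icc]
      have h3 : ¬(k + a + 1 ≤ j ∧ j ≤ k + a + 1 + h) := by omega
      have h4 : ¬(k ≤ j ∧ j ≤ k + a) := by omega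
      tauto
    · intro j h1 h2
      simp only [Finset.mem_union, Finset.mem_sdiff, Finset.mem_Icc]
      omega
  have g1 : gammaFrom p (Finset.Icc k (k + a)) (r + 1 + h + 1 + a + 1) k
      = G (inL p _ (Gam p)) := by
    rw [hGL, gammaFrom_last_block p a rfl (fun j h1 h2 => Finset.mem_Icc.2 ⟨h1, h2⟩)]
    intro j h1 h2
    rw [Finset.mem_Icc] at h1
    omega
  have g2 : gammaFrom p (Finset.Icc (k + a + 1) (k + a + 1 + h)) (r + 1 + h + 1 + a + 1) k
      = G (inR p _ (inL p _ (Gam p))) := by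
    rw [gammaFrom_spread p a (e := k + a + 1) rfl, hGR, hFL,
      gammaFrom_last_block p h rfl (fun j h1 h2 => Finset.mem_Icc.2 ⟨h1, h2⟩)]
    · intro j h1 h2
      rw [Finset.mem_Icc] at h1
      omega
    · intro j h1 h2
      rw [Finset.mem_Icc]
      omega
  have g3 : gammaFrom p (A \ Finset.Icc k (k + a)) (r + 1 + h + 1 + a + 1) k
      = G (inR p _ (inR p _ (cgen p .g))) := by
    have hn : k + a + 1 + h + 1 ∈ A \ Finset.Icc k (k + a) := by
      rw [Finset.mem_sdiff, Finset.mem_Icc]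
      exact ⟨hnext, by omega⟩
    rw [gammaFrom_spread p a (e := k + a + 1) rfl, hGR, hFR,
      gammaFrom_spread p h (e := k + a + 1 + h + 1) rfl, gammaFrom_of_mem p hn,
      (ext_congr p r _ _).1 hn hnext]
    · intro j h1 h2
      rw [Finset.mem_sdiff, Finset.mem_Icc]
      exact and_iff_left (by omega)
    · intro j h1 h2
      rw [Finset.mem_sdiff]
      exact fun h3 => hhole j h1 (by omega) h3.1
    · intro j h1 h2
      rw [Finset.mem_sdiff, Finset.mem_Icc]
      omega
  rw [g13, g12, g23, g1, g2, g123, g3]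
  -- All seven terms are now images under the algebra morphism G, so the relation transfers.
  have := congrArg G (rank_three_relation p)
  simpa only [map_add, map_sub, map_smul, map_mul] using this

end Relation

/-! ### Generation by intervals -/

section Generation

/-- The subalgebra generated by the elements `Γ_{[i;j]}` with `k ≤ i ≤ j < k + n`, in the notation
of `gammaFrom`. -/
def intervalAlg (n k : ℕ) : Subalgebra ℂ (Pow p n) :=
  Algebra.adjoin ℂ {x | ∃ i j : ℕ, k ≤ i ∧ i ≤ j ∧ j < k + n ∧
    x = gammaFrom p (Finset.Icc i j) n k}

lemma gammaFrom_Icc_mem_intervalAlg {n k i j : ℕ} (hi : k ≤ i) (hij : i ≤ j) (hj : j < k + n) :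
    gammaFrom p (Finset.Icc i j) n k ∈ intervalAlg p n k :=
  Algebra.subset_adjoin ⟨i, j, hi, hij, hj, rfl⟩

lemma map_shift_intervalAlg_le (n k : ℕ) :
    (intervalAlg p n (k + 1)).map (shift p n) ≤ intervalAlg p (n + 1) k := by
  rw [intervalAlg, AlgHom.map_adjoin]
  refine Algebra.adjoin_le ?_
  rintro _ ⟨_, ⟨i, j, hi, hij, hj, rfl⟩, rfl⟩
  rw [← gammaFrom_of_notMem p (by rw [Finset.mem_Icc]; omega)]
  exact gammaFrom_Icc_mem_intervalAlg p (by omega) hij (by omega)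

theorem gammaFrom_mem_intervalAlg (n : ℕ) : ∀ (k : ℕ) (A : Finset ℕ),
    gammaFrom p A n k ∈ intervalAlg p n k := by
  induction n with
  -- With no factor left the value is the scalar Γ_∅, which lies in any unital subalgebra.
  | zero => exact fun k A => Subalgebra.smul_mem _ (one_mem _) _
  | succ n ih =>
    intro k A
    -- Sets avoiding k come from the remaining n factors, and prefixing a unit preserves intervals.
    have hout (B : Finset ℕ) (hB : k ∉ B) :
        gammaFrom p B (n + 1) k ∈ intervalAlg p (n + 1) k := by
      rw [gammaFrom_of_notMem p hB]
      exact map_shift_intervalAlg_le p n k ⟨_, ih (k + 1) B, rfl⟩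
    induction hc : (Finset.Icc k (k + n) \ A).card using Nat.strong_induction_on generalizing A with
    | _ c ihc =>
    by_cases hk : k ∉ A
    · exact hout A hk
    rw [not_not] at hk
    -- The least such a makes {k, …, k + a} the first block of A; the alternative a = n stops it at
    -- the end of the window.
    have hex : ∃ a, a = n ∨ k + a + 1 ∉ A := ⟨n, Or.inl rfl⟩
    obtain ⟨a, ha, hmin⟩ : ∃ a, (a = n ∨ k + a + 1 ∉ A) ∧ ∀ b < a, b ≠ n ∧ k + b + 1 ∈ A :=
      ⟨Nat.find hex, Nat.find_spec hex, fun b hb => by simpa using Nat.find_min hex hb⟩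
    obtain ⟨m, rfl⟩ : ∃ m, n = m + a := by
      refine ⟨n - a, (Nat.sub_add_cancel ?_).symm⟩
      by_contra h
      exact (hmin n (by omega)).1 rfl
    have hblock : ∀ j, k ≤ j → j ≤ k + a → j ∈ A := by
      intro j h1 h2
      obtain rfl | h3 := h1.eq_or_lt
      · exact hk
      · have := (hmin (j - k - 1) (by omega)).2
        rwa [show k + (j - k - 1) + 1 = j by omega] at this
    by_cases hlast : ∀ j ∈ A, k + a < j → k + a + m < j
    · rw [gammaFrom_last_block p a rfl hblock hlast, ← gammaFrom_last_block p a rfl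
        (A := Finset.Icc k (k + a)) (fun j h1 h2 => Finset.mem_Icc.2 ⟨h1, h2⟩)
        (fun j hj h => absurd (Finset.mem_Icc.1 hj).2 (by omega))]
      exact gammaFrom_Icc_mem_intervalAlg p le_rfl (by omega) (by omega)
    push Not at hlast
    have ha' : k + a + 1 ∉ A := by
      obtain ⟨j, -, h1, h2⟩ := hlast
      exact ha.resolve_left (by omega)
    have hex' : ∃ j, j ∈ A ∧ k + a < j := by
      obtain ⟨j, h1, h2, -⟩ := hlast
      exact ⟨j, h1, h2⟩
    obtain ⟨e, heA, hae, hem, hemin⟩ : ∃ e ∈ A, k + a < e ∧ e ≤ k + a + m ∧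
        ∀ j, k + a < j → j < e → j ∉ A := by
      refine ⟨Nat.find hex', (Nat.find_spec hex').1, (Nat.find_spec hex').2, ?_, ?_⟩
      · obtain ⟨j, h1, h2, h3⟩ := hlast
        exact (Nat.find_min' hex' ⟨h1, h2⟩).trans h3
      · exact fun j h1 h2 h3 => Nat.find_min hex' h2 ⟨h3, h1⟩
    have hne : e ≠ k + a + 1 := fun h => ha' (h ▸ heA)
    obtain ⟨h, rfl⟩ : ∃ h, e = k + a + 1 + h + 1 := ⟨e - (k + a + 1 + 1), by omega⟩
    -- The truncated subtraction is exact: the next point k + a + h + 2 of A is at most k + a + m,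
    -- so h + 2 ≤ m.
    rw [gammaFrom_relation p a h (m - h - 2) k hblock
      (fun j h1 h2 => hemin j (by omega) (by omega)) heA _ (by omega)]
    have hX := gammaFrom_Icc_mem_intervalAlg p (n := m + a + 1) (k := k) (i := k)
      (j := k + a + 1 + h) le_rfl (by omega) (by omega)
    have h1 := gammaFrom_Icc_mem_intervalAlg p (n := m + a + 1) (k := k) (i := k)
      (j := k + a) le_rfl (by omega) (by omega)
    have h2 := gammaFrom_Icc_mem_intervalAlg p (n := m + a + 1) (k := k) (i := k + a + 1)
      (j := k + a + 1 + h) (by omega) (by omega) (by omega)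
    have h3 := hout (A \ Finset.Icc k (k + a)) (by simp)
    have hY := hout (A \ Finset.Icc k (k + a) ∪ Finset.Icc (k + a + 1) (k + a + 1 + h))
      (by simp)
    -- The only term needing the inner induction; the point k + a + 1 witnesses that fewer points
    -- are missing.
    have hB := ihc _ ?_ (A ∪ Finset.Icc (k + a + 1) (k + a + 1 + h)) rfl
    · exact sub_mem (add_mem (Subalgebra.smul_mem _ (mul_mem hX hY) _)
        (Subalgebra.smul_mem _ (mul_mem hY hX) _))
        (Subalgebra.smul_mem _ (add_mem (mul_mem h2 hB) (mul_mem h1 h3)) _)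
    · rw [← hc]
      apply Finset.card_lt_card
      rw [Finset.ssubset_iff_of_subset
        (Finset.sdiff_subset_sdiff le_rfl Finset.subset_union_left)]
      refine ⟨k + a + 1, ?_, ?_⟩
      · rw [Finset.mem_sdiff, Finset.mem_Icc]
        exact ⟨by omega, ha'⟩
      · simp

end Generation

end QBannaiIto

end

theorem corollary2p6 (p : QBannaiIto.Parameter) (n : ℕ) (hn : 3 ≤ n) :
    Algebra.adjoin ℂ {x : QBannaiIto.Pow p n |
        ∃ i j : ℕ, 1 ≤ i ∧ i ≤ j ∧ j ≤ n ∧ x = QBannaiIto.Gamma p n (Finset.Icc i j)}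
      = QBannaiIto.qBannaiIto p n := by
  apply le_antisymm
  · refine Algebra.adjoin_mono ?_
    rintro x ⟨i, j, hi, -, hj, rfl⟩
    exact ⟨_, Finset.Icc_subset_Icc hi hj, rfl⟩
  · refine Algebra.adjoin_le ?_
    rintro x ⟨A, -, rfl⟩
    refine Algebra.adjoin_mono ?_ (QBannaiIto.gammaFrom_mem_intervalAlg p n 1 A)
    rintro x ⟨i, j, hi, hij, hj, rfl⟩
    exact ⟨i, j, hi, hij, by omega, rfl⟩
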